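/- Let $G$ be a non-empty locally compact Hausdorff ample groupoid, i.e. a groupoid with a locally compact Hausdorff topology for which product and inversion are continuous and which has a basis consisting of compact open bisections. Here $r(g)=gg^{-1}$ and $d(g)=g^{-1}g$, $G^{(0)}$ is the set of units, and a bisection is a subset $S\subseteq G$ on which $r$ and $d$ restrict to homeomorphisms onto open subsets of $G$; let $G^a$ be the family of all compact open bisections. Suppose that $G^{(0)}$ is compact and that $G$ is minimal, i.e. $\emptyset$ and $G^{(0)}$ are the only closed subsets $D$ of $G^{(0)}$ that are invariant ($d(g)\in D$ implies $r(g)\in D$). Then the following are equivalent: 1. the reduced groupoid $C^*$-algebra $C_r^*(G)$ (the completion of the convolution $*$-algebra $C_c(G)$ in the norm $\|f\|_r=\sup_{u\in G^{(0)}}\|\pi_u(f)\|$, where $\pi_u(f)\xi=f*\xi$ on $\ell^2(d^{-1}(u))$) admits a faithful tracial state; 2. $C_r^*(G)$ is stably finite, i.e. for every $n\in\mathbb N$ the unit of $M_n(C_r^*(G))$ is a finite projection (not Murray–von Neumann equivalent to a proper subprojection); 3. every clopen subset $A$ of $G^{(0)}$ is completely $G^a$-non-paradoxical, i.e. for no integers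 $k>l>0$ is $A$ $(G^a,k,l)$-paradoxical. Here a non-empty $A\subseteq G^{(0)}$ is $(G^a,k,l)$-paradoxical if for each $1\le i\le k$ there are $n_i\in\mathbb N$, $V_{i,1},\dots,V_{i,n_i}\in G^a$ and $m_{i,1},\dots,m_{i,n_i}\in\{1,\dots,l\}$ such that $\bigcup_{j}d(V_{i,j})=A$ for every $i$ and the sets $r(V_{i,j})\times\{m_{i,j}\}\subseteq A\times\{1,\dots,l\}$ are pairwise disjoint (over all pairs $(i,j)$); the empty set is never paradoxical; 4. there is a faithful state $\varphi:S(G,G^a)\to[0,\infty)$ with $\varphi([G^{(0)}])=1$. Here the type semigroup $S(G,G^a)$ is the abelian monoid of equivalence classes of sets $\bigcup_{i=1}^n A_i\times\{i\}$ with $n\in\mathbb N$ and $A_i\subseteq G^{(0)}$ compact open, where $A\sim B$ if there are $l\in\mathbb N$, $W_1,\dots,W_l\in G^a$ and $n_1,\dots,n_l,m_1,\dots,m_l\in\mathbb N$ with $A=\bigsqcup_{k} d(W_k)\times\{n_k\}$ and $B=\bigsqcup_{k} r(W_k)\times\{m_k\}$; addition is $[\bigcup_{i=1}^n A_i\times\{i\}]+[\bigcup_{j=1}^m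 B_j\times\{j\}]=[\bigcup_{i=1}^n A_i\times\{i\}\cup\bigcup_{j=1}^m B_j\times\{n+j\}]$, the order is the algebraic preorder ($x\le y$ iff $y=x+z$ for some $z$), and $[A]$ denotes the class of $A\times\{1\}$. A state is an additive order preserving map with $\varphi(0)=0$; it is faithful if $\varphi(x)=0$ only for $x=0$. -/

import Mathlib

open Set Topology

/-- A groupoid: a set `G` with a relation `Composable` (the set of composable pairs), a product
defined on composable pairs and an inversion. The product is a total function; its values on
pairs that are not composable carry no information and are never used. -/
class AlgGroupoid (G : Type*) extends Mul G, Inv G where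
  Composable : G → G → Prop
  composable_mul_left : ∀ {a b c : G}, Composable a b → Composable b c → Composable (a * b) c
  composable_mul_right : ∀ {a b c : G}, Composable a b → Composable b c → Composable a (b * c)
  mul_assoc' : ∀ {a b c : G}, Composable a b → Composable b c → (a * b) * c = a * (b * c)
  composable_inv : ∀ g : G, Composable g g⁻¹
  composable_inv_mul : ∀ {g h : G}, Composable g h → Composable g⁻¹ (g * h)
  inv_mul_cancel' : ∀ {g h : G}, Composable g h → g⁻¹ * (g * h) = h
  composable_mul_inv : ∀ {g h : G}, Composable g h → Composable (g * h) h⁻¹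
  mul_inv_cancel' : ∀ {g h : G}, Composable g h → (g * h) * h⁻¹ = g

namespace AlgGroupoid

variable {G : Type*} [AlgGroupoid G]

/-- The range map `r(g) = g g⁻¹`. -/
def rng (g : G) : G := g * g⁻¹

/-- The domain map `d(g) = g⁻¹ g`. -/
def dom (g : G) : G := g⁻¹ * g

variable (G) in
/-- The set of units `G⁽⁰⁾ = {g g⁻¹ | g ∈ G}`. -/
def units : Set G := Set.range (rng : G → G)

/-- A subset `D` of the unit space is invariant if `d(g) ∈ D` implies `r(g) ∈ D`. -/
def IsInvariant (D : Set G) : Prop := ∀ g : G, dom g ∈ D → rng g ∈ D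

theorem composable_inv_left (g : G) : Composable g⁻¹ g := by
  have h := composable_mul_right (composable_inv_mul (composable_inv g))
    (composable_mul_inv (composable_inv g))
  have h2 := mul_inv_cancel' (composable_inv g)
  rw [h2] at h
  exact h

theorem inv_inv' (g : G) : g⁻¹⁻¹ = g := by
  have h1 : g⁻¹⁻¹ * (g⁻¹ * g) = g := inv_mul_cancel' (composable_inv_left g)
  have h2 : g⁻¹⁻¹ * (g⁻¹ * g⁻¹⁻¹) = g⁻¹⁻¹ := inv_mul_cancel' (composable_inv g⁻¹)
  have h3 : g * (g⁻¹ * g⁻¹⁻¹) = g := by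
    rw [← mul_assoc' (composable_inv g) (composable_inv g⁻¹)]
    exact mul_inv_cancel' (composable_inv g)
  have h4 : g⁻¹ * (g * (g⁻¹ * g⁻¹⁻¹)) = g⁻¹ * g⁻¹⁻¹ :=
    inv_mul_cancel' (composable_mul_right (composable_inv g) (composable_inv g⁻¹))
  rw [h3] at h4
  rw [← h2, ← h4, h1]

theorem dom_eq_rng {g h : G} (c : Composable g h) : dom g = rng h := by
  have h1 : g⁻¹ * ((g * h) * h⁻¹) = (g⁻¹ * (g * h)) * h⁻¹ :=
    (mul_assoc' (composable_inv_mul c) (composable_mul_inv c)).symm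
  rw [mul_inv_cancel' c, inv_mul_cancel' c] at h1
  exact h1

theorem rng_mul_self (g : G) : rng g * g = g := by
  have := mul_inv_cancel' (composable_inv g)
  rwa [inv_inv'] at this

theorem mul_dom_self (g : G) : g * dom g = g := by
  have := inv_mul_cancel' (composable_inv_left g)
  rwa [inv_inv'] at this

theorem composable_iff {g h : G} : Composable g h ↔ dom g = rng h := by
  refine ⟨dom_eq_rng, fun e => ?_⟩
  have h1 : Composable g (dom g) := composable_mul_right (composable_inv g) (composable_inv_left g)
  have h2 : Composable (dom g) h := by
    rw [e]
    exact composable_mul_left (composable_inv h) (composable_inv_left h)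
  have h3 := composable_mul_left h1 h2
  rwa [mul_dom_self] at h3

@[simp] theorem rng_inv (g : G) : rng g⁻¹ = dom g := by simp [rng, dom, inv_inv']
@[simp] theorem dom_inv (g : G) : dom g⁻¹ = rng g := by simp [rng, dom, inv_inv']

theorem rng_mul {g h : G} (c : Composable g h) : rng (g * h) = rng g := by
  rw [← dom_eq_rng (composable_inv_mul c), dom_inv]

theorem dom_mul {g h : G} (c : Composable g h) : dom (g * h) = dom h := by
  rw [dom_eq_rng (composable_mul_inv c), rng_inv]

@[simp] theorem rng_rng (g : G) : rng (rng g) = rng g := rng_mul (composable_inv g)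
@[simp] theorem dom_rng (g : G) : dom (rng g) = rng g := by
  rw [rng, dom_mul (composable_inv g), dom_inv, rng]
@[simp] theorem rng_dom (g : G) : rng (dom g) = dom g := by
  rw [dom, rng_mul (composable_inv_left g), rng_inv, dom]
@[simp] theorem dom_dom (g : G) : dom (dom g) = dom g := dom_mul (composable_inv_left g)

theorem mem_units_iff {u : G} : u ∈ units G ↔ rng u = u :=
  ⟨by rintro ⟨g, rfl⟩; simp, fun h => ⟨u, h⟩⟩

theorem rng_mem_units (g : G) : rng g ∈ units G := ⟨g, rfl⟩
theorem dom_mem_units (g : G) : dom g ∈ units G := ⟨g⁻¹, by simp⟩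

theorem rng_of_unit {u : G} (h : u ∈ units G) : rng u = u := mem_units_iff.1 h
theorem dom_of_unit {u : G} (h : u ∈ units G) : dom u = u := by
  obtain ⟨g, rfl⟩ := h; simp

theorem inv_of_unit {u : G} (h : u ∈ units G) : u⁻¹ = u := by
  have h1 := rng_mul_self u⁻¹
  rw [rng_inv, dom_of_unit h] at h1
  have h2 : u * u⁻¹ = u := rng_of_unit h
  rw [← h1, h2]

theorem composable_inv_mul_of_rng {g h : G} (e : rng h = rng g) : Composable h⁻¹ g :=
  composable_iff.2 (by simpa using e)

theorem mul_inv_mul_cancel {g h : G} (e : rng h = rng g) : h * (h⁻¹ * g) = g := by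
  have := inv_mul_cancel' (composable_inv_mul_of_rng e)
  rwa [inv_inv'] at this

theorem composable_mul_inv_of_dom {g h : G} (e : dom g = dom h) : Composable g h⁻¹ :=
  composable_iff.2 (by simpa using e)

theorem mul_inv_mul_cancel_right {g h : G} (e : dom g = dom h) : (g * h⁻¹) * h = g := by
  have := mul_inv_cancel' (composable_mul_inv_of_dom e)
  rwa [inv_inv'] at this

theorem mul_inv_rev' {g h : G} (c : Composable g h) : (g * h)⁻¹ = h⁻¹ * g⁻¹ := by
  have hc : dom g = rng h := dom_eq_rng c
  have c1 : Composable h⁻¹ g⁻¹ := composable_iff.2 (by simp [hc])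
  have c2 : Composable (h⁻¹ * g⁻¹) (g * h) :=
    composable_iff.2 (by rw [dom_mul c1, rng_mul c, dom_inv])
  have e1 : (h⁻¹ * g⁻¹) * (g * h) = dom h := by
    rw [mul_assoc' c1 (composable_inv_mul c), inv_mul_cancel' c, dom]
  have e2 := mul_inv_cancel' c2
  rw [e1] at e2
  rw [← e2]
  have := rng_mul_self (g * h)⁻¹
  rw [rng_inv, dom_mul c] at this
  exact this.symm

/-- Convolution of two complex functions,
`(f₁ ∗ f₂)(g) = ∑_{h : r(h) = r(g)} f₁(h) f₂(h⁻¹ g)`. The sum is meant for functions `f₁` that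
meet each fibre of `r` in a finite set. -/
noncomputable def conv (f₁ f₂ : G → ℂ) (g : G) : ℂ :=
  ∑ᶠ (h : G) (_ : rng h = rng g), f₁ h * f₂ (h⁻¹ * g)

section Topology

variable [TopologicalSpace G]

/-- A bisection: a subset to which the range and the domain map restrict as homeomorphisms onto
open subsets of `G`. -/
def IsBisection (S : Set G) : Prop :=
  IsOpenEmbedding (fun s : S => rng (s : G)) ∧ IsOpenEmbedding (fun s : S => dom (s : G))

variable (G) in
/-- The family of all compact open bisections. -/
def compactOpenBisections : Set (Set G) := {S | IsCompact S ∧ IsOpen S ∧ IsBisection S}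

end Topology

end AlgGroupoid

open AlgGroupoid

/-- A topological groupoid: inversion and product are continuous. -/
class IsTopologicalGroupoid (G : Type*) [AlgGroupoid G] [TopologicalSpace G] : Prop where
  continuous_inv : Continuous (fun g : G => g⁻¹)
  continuousOn_mul : ContinuousOn (fun p : G × G => p.1 * p.2) {p | Composable p.1 p.2}

/-- A topological groupoid is ample if it has a basis of compact open bisections. -/
class IsAmpleGroupoid (G : Type*) [AlgGroupoid G] [TopologicalSpace G] : Prop
    extends IsTopologicalGroupoid G where
  isTopologicalBasis : TopologicalSpace.IsTopologicalBasis (compactOpenBisections G)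

/-- A topological groupoid is minimal if the only closed invariant subsets of its unit space are
the empty set and the whole unit space. -/
def IsMinimalGroupoid (G : Type*) [AlgGroupoid G] [TopologicalSpace G] : Prop :=
  ∀ D : Set G, D ⊆ units G → IsClosed ((↑) ⁻¹' D : Set (units G)) → IsInvariant D →
    D = ∅ ∨ D = units G

namespace AlgGroupoid

variable {G : Type*} [AlgGroupoid G] [TopologicalSpace G] [IsAmpleGroupoid G]

theorem continuous_inv' : Continuous (fun g : G => g⁻¹) := IsTopologicalGroupoid.continuous_inv

theorem continuousOn_mul_comp {X : Type*} [TopologicalSpace X] {s : Set X} {a b : X → G}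
    (ha : ContinuousOn a s) (hb : ContinuousOn b s) (h : ∀ x ∈ s, dom (a x) = rng (b x)) :
    ContinuousOn (fun x => a x * b x) s :=
  IsTopologicalGroupoid.continuousOn_mul.comp (ha.prodMk hb) fun x hx => composable_iff.2 (h x hx)

theorem continuous_rng : Continuous (rng : G → G) := by
  rw [← continuousOn_univ]
  exact continuousOn_mul_comp continuousOn_id continuous_inv'.continuousOn (by simp)

theorem continuous_dom : Continuous (dom : G → G) := by
  rw [← continuousOn_univ]
  exact continuousOn_mul_comp continuous_inv'.continuousOn continuousOn_id (by simp)

theorem isOpenMap_rng : IsOpenMap (rng : G → G) :=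
  IsAmpleGroupoid.isTopologicalBasis.isOpenMap_iff.2 fun S hS => by
    have := hS.2.2.1.isOpen_range
    rwa [← Set.image_eq_range] at this

theorem isOpenMap_dom : IsOpenMap (dom : G → G) :=
  IsAmpleGroupoid.isTopologicalBasis.isOpenMap_iff.2 fun S hS => by
    have := hS.2.2.2.isOpen_range
    rwa [← Set.image_eq_range] at this

theorem mem_compactOpenBisections {S : Set G} : S ∈ compactOpenBisections G ↔
    IsCompact S ∧ IsOpen S ∧ InjOn rng S ∧ InjOn dom S := by
  refine ⟨fun h => ⟨h.1, h.2.1, injOn_iff_injective.2 h.2.2.1.injective,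
    injOn_iff_injective.2 h.2.2.2.injective⟩, fun h => ⟨h.1, h.2.1, ?_, ?_⟩⟩
  · exact .of_continuous_injective_isOpenMap (continuous_rng.comp continuous_subtype_val)
      (injOn_iff_injective.1 h.2.2.1) (isOpenMap_rng.comp h.2.1.isOpenMap_subtype_val)
  · exact .of_continuous_injective_isOpenMap (continuous_dom.comp continuous_subtype_val)
      (injOn_iff_injective.1 h.2.2.2) (isOpenMap_dom.comp h.2.1.isOpenMap_subtype_val)

theorem empty_mem_compactOpenBisections : (∅ : Set G) ∈ compactOpenBisections G :=
  mem_compactOpenBisections.2 ⟨isCompact_empty, isOpen_empty, by simp, by simp⟩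

theorem isOpen_units : IsOpen (units G) := by
  rw [isOpen_iff_forall_mem_open]
  intro u hu
  obtain ⟨S, hS, huS, -⟩ :=
    IsAmpleGroupoid.isTopologicalBasis.exists_subset_of_mem_open (mem_univ u) isOpen_univ
  have hS' := mem_compactOpenBisections.1 hS
  refine ⟨S ∩ rng ⁻¹' S, ?_, hS'.2.1.inter (hS'.2.1.preimage continuous_rng), huS, ?_⟩
  · rintro g ⟨h1, h2⟩
    exact mem_units_iff.2 (hS'.2.2.1 h2 h1 (rng_rng g))
  · simpa [rng_of_unit hu] using huS

theorem isClosed_units [T2Space G] : IsClosed (units G) := by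
  have : units G = {u | rng u = u} := by ext; exact mem_units_iff
  rw [this]
  exact isClosed_eq continuous_rng continuous_id

theorem mem_compactOpenBisections_of_subset_units {A : Set G} (hc : IsCompact A) (ho : IsOpen A)
    (hA : A ⊆ units G) : A ∈ compactOpenBisections G :=
  mem_compactOpenBisections.2 ⟨hc, ho,
    fun x hx y hy h => by rwa [rng_of_unit (hA hx), rng_of_unit (hA hy)] at h,
    fun x hx y hy h => by rwa [dom_of_unit (hA hx), dom_of_unit (hA hy)] at h⟩

variable (G) in
theorem units_mem_compactOpenBisections [CompactSpace (units G)] :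
    units G ∈ compactOpenBisections G :=
  mem_compactOpenBisections_of_subset_units (isCompact_iff_compactSpace.2 inferInstance)
    isOpen_units subset_rfl

theorem isCompact_setMul [T2Space G] {K L : Set G} (hK : IsCompact K) (hL : IsCompact L) :
    IsCompact {x : G | ∃ v ∈ K, ∃ w ∈ L, dom v = rng w ∧ x = v * w} := by
  have h1 : IsCompact ((K ×ˢ L) ∩ {p : G × G | dom p.1 = rng p.2}) :=
    (hK.prod hL).inter_right (isClosed_eq (continuous_dom.comp continuous_fst)
      (continuous_rng.comp continuous_snd))
  have h2 := h1.image_of_continuousOn (f := fun p : G × G => p.1 * p.2)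
    (continuousOn_mul_comp continuousOn_fst continuousOn_snd fun x hx => hx.2)
  convert h2 using 1
  ext x
  constructor
  · rintro ⟨v, hv, w, hw, e, rfl⟩
    exact ⟨(v, w), ⟨⟨hv, hw⟩, e⟩, rfl⟩
  · rintro ⟨⟨v, w⟩, ⟨⟨hv, hw⟩, e⟩, rfl⟩
    exact ⟨v, hv, w, hw, e, rfl⟩

/-- The inverse of an injective open map on an open set is continuous on the image. -/
theorem continuousOn_section {G : Type*} [TopologicalSpace G] {f s : G → G} (hf : IsOpenMap f) {S : Set G} (hS : IsOpen S)
    (hs : ∀ x ∈ S, s (f x) = x) : ContinuousOn s (f '' S) := by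
  rw [continuousOn_open_iff (hf S hS)]
  intro t ht
  have : f '' S ∩ s ⁻¹' t = f '' (S ∩ t) := by
    ext y
    constructor
    · rintro ⟨⟨x, hx, rfl⟩, h2⟩
      rw [mem_preimage, hs x hx] at h2
      exact ⟨x, ⟨hx, h2⟩, rfl⟩
    · rintro ⟨x, ⟨hx, hxt⟩, rfl⟩
      exact ⟨⟨x, hx, rfl⟩, by rwa [mem_preimage, hs x hx]⟩
  rw [this]
  exact hf _ (hS.inter ht)

theorem mul_mem_compactOpenBisections [T2Space G] {V W : Set G}
    (hV : V ∈ compactOpenBisections G) (hW : W ∈ compactOpenBisections G) :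
    {x : G | ∃ v ∈ V, ∃ w ∈ W, dom v = rng w ∧ x = v * w} ∈ compactOpenBisections G := by
  obtain ⟨hVc, hVo, hVr, hVd⟩ := mem_compactOpenBisections.1 hV
  obtain ⟨hWc, hWo, hWr, hWd⟩ := mem_compactOpenBisections.1 hW
  refine mem_compactOpenBisections.2 ⟨isCompact_setMul hVc hWc, ?_, ?_, ?_⟩
  · rcases isEmpty_or_nonempty G with hG | hG
    · rw [Set.eq_empty_of_isEmpty {x : G | ∃ v ∈ V, ∃ w ∈ W, dom v = rng w ∧ x = v * w}]
      exact isOpen_empty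
    let s : G → G := Function.invFunOn dom W
    have hs : ∀ x ∈ W, s (dom x) = x := hWd.leftInvOn_invFunOn
    have hsc : ContinuousOn s (dom '' W) := continuousOn_section isOpenMap_dom hWo hs
    have hmem : ∀ x, dom x ∈ dom '' W → s (dom x) ∈ W ∧ dom (s (dom x)) = dom x := by
      rintro x ⟨w, hw, e⟩
      rw [← e, hs w hw]
      exact ⟨hw, rfl⟩
    have hc : ContinuousOn (fun x : G => x * (s (dom x))⁻¹) (dom ⁻¹' (dom '' W)) :=
      continuousOn_mul_comp continuousOn_id
        (continuous_inv'.comp_continuousOn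
          (hsc.comp continuous_dom.continuousOn fun x hx => hx))
        fun x hx => by simp [(hmem x hx).2]
    have ho := hc.isOpen_inter_preimage ((isOpenMap_dom W hWo).preimage continuous_dom) hVo
    convert ho using 1
    ext x
    constructor
    · rintro ⟨v, hv, w, hw, e, rfl⟩
      have c := composable_iff.2 e
      refine ⟨⟨w, hw, (dom_mul c).symm⟩, ?_⟩
      simp only [mem_preimage, dom_mul c, hs w hw]
      rwa [mul_inv_cancel' c]
    · rintro ⟨hx, hxV⟩
      obtain ⟨h1, h2⟩ := hmem x hx
      refine ⟨_, hxV, _, h1, ?_, (mul_inv_mul_cancel_right h2.symm).symm⟩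
      rw [dom_mul (composable_mul_inv_of_dom h2.symm), dom_inv]
  · rintro _ ⟨v, hv, w, hw, e, rfl⟩ _ ⟨v', hv', w', hw', e', rfl⟩ h
    rw [rng_mul (composable_iff.2 e), rng_mul (composable_iff.2 e')] at h
    obtain rfl := hVr hv hv' h
    obtain rfl := hWr hw hw' (e.symm.trans e')
    rfl
  · rintro _ ⟨v, hv, w, hw, e, rfl⟩ _ ⟨v', hv', w', hw', e', rfl⟩ h
    rw [dom_mul (composable_iff.2 e), dom_mul (composable_iff.2 e')] at h
    obtain rfl := hWd hw hw' h
    obtain rfl := hVd hv hv' (e.trans e'.symm)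
    rfl

theorem inv_mem_compactOpenBisections {V : Set G} (hV : V ∈ compactOpenBisections G) :
    {x : G | x⁻¹ ∈ V} ∈ compactOpenBisections G := by
  obtain ⟨hVc, hVo, hVr, hVd⟩ := mem_compactOpenBisections.1 hV
  refine mem_compactOpenBisections.2 ⟨?_, hVo.preimage continuous_inv', ?_, ?_⟩
  · have := hVc.image (continuous_inv' (G := G))
    convert this using 1
    ext x
    exact ⟨fun h => ⟨x⁻¹, h, inv_inv' x⟩, by rintro ⟨y, hy, rfl⟩; simpa [inv_inv'] using hy⟩
  · intro x hx y hy h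
    have := hVd hx hy (by simpa using h)
    rw [← inv_inv' x, this, inv_inv']
  · intro x hx y hy h
    have := hVr hx hy (by simpa using h)
    rw [← inv_inv' x, this, inv_inv']

end AlgGroupoid

namespace AlgGroupoid

variable {G : Type*} [AlgGroupoid G] [TopologicalSpace G] [IsAmpleGroupoid G] [T2Space G]

/-- Every function in `C_c(G)` is a finite sum of functions in `C_c(G)` that are supported in a
compact open bisection. -/
theorem cc_induction {P : CompactlySupportedContinuousMap G ℂ → Prop}
    (hbis : ∀ f, ∀ S ∈ compactOpenBisections G, (∀ x ∉ S, f x = 0) → P f)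
    (hadd : ∀ f g, P f → P g → P (f + g)) (f : CompactlySupportedContinuousMap G ℂ) : P f := by
  classical
  have key : ∀ (F : Finset (Set G)), (∀ S ∈ F, S ∈ compactOpenBisections G) →
      ∀ f : CompactlySupportedContinuousMap G ℂ, (∀ x, (∀ S ∈ F, x ∉ S) → f x = 0) → P f := by
    intro F
    induction F using Finset.induction_on with
    | empty =>
      intro _ f hf
      exact hbis f ∅ empty_mem_compactOpenBisections fun x _ => hf x (by simp)
    | insert S F hSF ih =>
      intro hF f hf
      have hS := hF S (by simp)
      have hcl : IsClopen S := ⟨hS.1.isClosed, hS.2.1⟩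
      have hcont : ∀ T : Set G, IsClopen T → Continuous (T.indicator f) := fun T hT =>
        (map_continuous f).indicator (by simp [hT.frontier_eq])
      have hsupp : ∀ T : Set G, HasCompactSupport (T.indicator f) := fun T =>
        f.hasCompactSupport.mono (by rw [Set.support_indicator]; exact inter_subset_right)
      let f1 : CompactlySupportedContinuousMap G ℂ := ⟨⟨S.indicator f, hcont S hcl⟩, hsupp S⟩
      let f2 : CompactlySupportedContinuousMap G ℂ :=
        ⟨⟨Sᶜ.indicator f, hcont Sᶜ hcl.compl⟩, hsupp Sᶜ⟩
      have hsum : f = f1 + f2 := by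
        ext x
        by_cases hx : x ∈ S <;> simp [f1, f2, hx]
      rw [hsum]
      refine hadd _ _ (hbis _ S hS fun x hx => by simp [f1, hx]) (ih (fun T hT => hF T (by simp [hT])) _ ?_)
      intro x hx
      by_cases hxS : x ∈ S
      · simp [f2, hxS]
      · have := hf x fun T hT => by
          rcases Finset.mem_insert.1 hT with rfl | h
          · exact hxS
          · exact hx T h
        simp [f2, hxS, this]
  obtain ⟨F, hF, hcov⟩ := (f.hasCompactSupport.isCompact).elim_finite_subcover_image
    (b := compactOpenBisections G) (c := id) (fun S hS => hS.2.1) (by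
      intro x _
      obtain ⟨S, hS, hx, -⟩ :=
        IsAmpleGroupoid.isTopologicalBasis.exists_subset_of_mem_open (mem_univ x) isOpen_univ
      exact mem_biUnion hS hx)
  refine key hcov.1.toFinset (fun S hS => hF (by simpa using hS)) f fun x hx => ?_
  by_contra h
  have := hcov.2 (subset_closure (Function.mem_support.2 h))
  obtain ⟨S, hS, hxS⟩ := mem_iUnion₂.1 this
  exact hx S (by simpa using hS) hxS

theorem finsum_cond_zero {p : Prop} {F : p → ℂ} (h : ∀ e, F e = 0) : ∑ᶠ e, F e = 0 := by
  rw [funext h, finsum_zero]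

theorem finsum_fibre_zero {α : Type*} {p : α → Prop} {F : α → ℂ} (h : ∀ x, p x → F x = 0) :
    ∑ᶠ (x : α) (_ : p x), F x = 0 := by
  rw [funext fun x => finsum_cond_zero (h x), finsum_zero]

theorem finite_fibre (f : CompactlySupportedContinuousMap G ℂ) (u : G) :
    ({h : G | rng h = u} ∩ Function.support f).Finite := by
  induction f using cc_induction with
  | hbis f S hS hf =>
    refine Set.Subsingleton.finite ?_
    have hi := (mem_compactOpenBisections.1 hS).2.2.1
    rintro x ⟨hx, hx'⟩ y ⟨hy, hy'⟩
    exact hi (by_contra fun h => hx' (hf x h)) (by_contra fun h => hy' (hf y h)) (hx.trans hy.symm)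
  | hadd f g hf hg =>
    refine (hf.union hg).subset ?_
    rintro x ⟨hx, hx'⟩
    by_cases h : f x = 0
    · right
      exact ⟨hx, fun h' => hx' (by simp [h, h'])⟩
    · exact Or.inl ⟨hx, h⟩

theorem finite_conv (f : CompactlySupportedContinuousMap G ℂ) (ξ : G → ℂ) (g : G) :
    ({h : G | rng h = rng g} ∩ Function.support fun h => f h * ξ (h⁻¹ * g)).Finite :=
  (finite_fibre f (rng g)).subset fun _ hx => ⟨hx.1, fun h => hx.2 (by simp [h])⟩

theorem conv_add_left (f f' : CompactlySupportedContinuousMap G ℂ) (ξ : G → ℂ) :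
    conv (f + f' : CompactlySupportedContinuousMap G ℂ) ξ = conv f ξ + conv f' ξ := by
  funext g
  refine Eq.trans ?_ (finsum_mem_add_distrib' (finite_conv f ξ g) (finite_conv f' ξ g))
  simp only [conv, CompactlySupportedContinuousMap.add_apply, add_mul]
  rfl

theorem conv_add_right (f : CompactlySupportedContinuousMap G ℂ) (ξ η : G → ℂ) :
    conv f (ξ + η) = conv f ξ + conv f η := by
  funext g
  refine Eq.trans ?_ (finsum_mem_add_distrib' (finite_conv f ξ g) (finite_conv f η g))
  simp only [conv, Pi.add_apply, mul_add]
  rfl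

theorem conv_smul_right {G : Type*} [AlgGroupoid G] (f ξ : G → ℂ) (c : ℂ) : conv f (c • ξ) = c • conv f ξ := by
  funext g
  simp only [conv, Pi.smul_apply, smul_finsum]
  refine finsum_congr fun h => finsum_congr fun _ => ?_
  simp only [smul_eq_mul]
  ring

theorem conv_smul_left {G : Type*} [AlgGroupoid G] (f ξ : G → ℂ) (c : ℂ) : conv (c • f) ξ = c • conv f ξ := by
  funext g
  simp only [conv, Pi.smul_apply, smul_finsum]
  simp only [smul_eq_mul, mul_assoc]

/-- Convolution by a function supported in a set on which the range map is injective. -/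
theorem conv_of_mem {G : Type*} [AlgGroupoid G] {f : G → ℂ} {S : Set G} (hS : InjOn rng S) (hf : ∀ x ∉ S, f x = 0)
    (ξ : G → ℂ) {h g : G} (hh : h ∈ S) (e : rng h = rng g) :
    conv f ξ g = f h * ξ (h⁻¹ * g) := by
  rw [conv, finsum_eq_single _ h, finsum_eq_single _ e]
  · intro x hx; exact absurd rfl hx
  · intro x hx
    refine finsum_cond_zero fun hxg => ?_
    by_cases hxS : x ∈ S
    · exact absurd (hS hxS hh (hxg.trans e.symm)) hx
    · simp [hf x hxS]

theorem conv_of_notMem {G : Type*} [AlgGroupoid G] {f : G → ℂ} {S : Set G} (hf : ∀ x ∉ S, f x = 0)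
    (ξ : G → ℂ) {g : G} (hg : ∀ h ∈ S, rng h ≠ rng g) : conv f ξ g = 0 := by
  refine finsum_fibre_zero fun h e => ?_
  rw [hf h fun hS => hg h hS e, zero_mul]

/-- The convolution of two functions in `C_c(G)` is in `C_c(G)`. -/
theorem conv_mem (f₁ f₂ : CompactlySupportedContinuousMap G ℂ) :
    Continuous (conv f₁ f₂) ∧ HasCompactSupport (conv f₁ f₂) := by
  induction f₁ using cc_induction with
  | hadd f g hf hg =>
    rw [conv_add_left]
    exact ⟨hf.1.add hg.1, hf.2.add hg.2⟩
  | hbis f S hS hf =>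
    obtain ⟨hSc, hSo, hSr, hSd⟩ := mem_compactOpenBisections.1 hS
    constructor
    · rcases isEmpty_or_nonempty G with hG | hG
      · exact continuous_of_discreteTopology
      let s : G → G := Function.invFunOn rng S
      have hs : ∀ x ∈ S, s (rng x) = x := hSr.leftInvOn_invFunOn
      have hsc : ContinuousOn s (rng '' S) := continuousOn_section isOpenMap_rng hSo hs
      have hmem : ∀ x, rng x ∈ rng '' S → s (rng x) ∈ S ∧ rng (s (rng x)) = rng x := by
        rintro x ⟨w, hw, e⟩
        rw [← e, hs w hw]
        exact ⟨hw, rfl⟩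
      let U : Set G := rng ⁻¹' (rng '' S)
      have hU : IsClopen U :=
        ⟨(hSc.image continuous_rng).isClosed.preimage continuous_rng,
          (isOpenMap_rng S hSo).preimage continuous_rng⟩
      have hsU : ContinuousOn (fun x : G => s (rng x)) U :=
        hsc.comp continuous_rng.continuousOn fun x hx => hx
      have h1 : ContinuousOn (fun g : G => f (s (rng g)) * f₂ ((s (rng g))⁻¹ * g)) U :=
        ((map_continuous f).comp_continuousOn hsU).mul
          ((map_continuous f₂).comp_continuousOn
            (continuousOn_mul_comp (continuous_inv'.comp_continuousOn hsU) continuousOn_id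
              fun x hx => by simp [(hmem x hx).2]))
      have h2 : ContinuousOn (conv f f₂) U :=
        h1.congr fun g hg => conv_of_mem hSr hf _ (hmem g hg).1 (hmem g hg).2
      have h3 : ContinuousOn (conv f f₂) Uᶜ :=
        (continuousOn_const (c := (0 : ℂ))).congr fun g hg =>
          conv_of_notMem hf _ fun h hh e => hg ⟨h, hh, e⟩
      rw [← continuousOn_univ, ← Set.union_compl_self U]
      exact h2.union_of_isOpen h3 hU.isOpen hU.compl.isOpen
    · refine HasCompactSupport.intro (isCompact_setMul hSc f₂.hasCompactSupport.isCompact) ?_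
      intro x hx
      by_cases h : ∃ h ∈ S, rng h = rng x
      · obtain ⟨h, hh, e⟩ := h
        rw [conv_of_mem hSr hf _ hh e]
        have : f₂ (h⁻¹ * x) = 0 := by
          by_contra h0
          refine hx ⟨h, hh, _, subset_closure (Function.mem_support.2 h0), ?_,
            (mul_inv_mul_cancel e).symm⟩
          rw [rng_mul (composable_inv_mul_of_rng e), rng_inv]
        rw [this, mul_zero]
      · exact conv_of_notMem hf _ fun h' hh e => h ⟨h', hh, e⟩

/-- The convolution product on `C_c(G)`. -/
noncomputable def ccMul (f₁ f₂ : CompactlySupportedContinuousMap G ℂ) :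
    CompactlySupportedContinuousMap G ℂ :=
  ⟨⟨conv f₁ f₂, (conv_mem f₁ f₂).1⟩, (conv_mem f₁ f₂).2⟩

/-- The involution `f*(g) = conj (f(g⁻¹))` on `C_c(G)`. -/
noncomputable def ccStar (f : CompactlySupportedContinuousMap G ℂ) :
    CompactlySupportedContinuousMap G ℂ where
  toFun g := star (f g⁻¹)
  continuous_toFun := continuous_star.comp ((map_continuous f).comp continuous_inv')
  hasCompactSupport' := by
    refine HasCompactSupport.intro (f.hasCompactSupport.isCompact.image continuous_inv') ?_
    intro x hx
    have : f x⁻¹ = 0 := by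
      by_contra h
      exact hx ⟨x⁻¹, subset_closure (Function.mem_support.2 h), inv_inv' x⟩
    simp [this]

variable (G) in
/-- The characteristic function of the unit space, for a compact unit space. -/
noncomputable def ccOne [CompactSpace (units G)] : CompactlySupportedContinuousMap G ℂ where
  toFun := (units G).indicator 1
  continuous_toFun := continuous_one.indicator (by
    simp [(show IsClopen (units G) from ⟨isClosed_units, isOpen_units⟩).frontier_eq])
  hasCompactSupport' :=
    HasCompactSupport.intro (K := units G) (isCompact_iff_compactSpace.2 inferInstance)
      fun x hx => by simp [hx]

/-- Left convolution by a function in `C_c(G)` is bounded on `ℓ²(G)`. -/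
theorem exists_conv_bound (f : CompactlySupportedContinuousMap G ℂ) :
    ∃ C : ℝ, 0 ≤ C ∧ ∀ ξ : lp (fun _ : G => ℂ) 2, ∀ F : Finset G,
      ∑ g ∈ F, ‖conv f ξ g‖ ^ 2 ≤ (C * ‖ξ‖) ^ 2 := by
  classical
  induction f using cc_induction with
  | hadd f g hf hg =>
    obtain ⟨C, hC, hf⟩ := hf
    obtain ⟨D, hD, hg⟩ := hg
    refine ⟨2 * (C + D), by positivity, fun ξ F => ?_⟩
    rw [conv_add_left]
    calc ∑ x ∈ F, ‖(conv f ξ + conv g ξ) x‖ ^ 2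
        ≤ ∑ x ∈ F, (2 * ‖conv f ξ x‖ ^ 2 + 2 * ‖conv g ξ x‖ ^ 2) := by
          refine Finset.sum_le_sum fun x _ => ?_
          have := norm_add_le (conv f ξ x) (conv g ξ x)
          rw [Pi.add_apply]
          nlinarith [norm_nonneg (conv f ξ x + conv g ξ x),
            sq_nonneg (‖conv f ξ x‖ - ‖conv g ξ x‖), norm_nonneg (conv f ξ x),
            norm_nonneg (conv g ξ x)]
      _ ≤ 2 * (C * ‖ξ‖) ^ 2 + 2 * (D * ‖ξ‖) ^ 2 := by
          rw [Finset.sum_add_distrib, ← Finset.mul_sum, ← Finset.mul_sum]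
          linarith [hf ξ F, hg ξ F]
      _ ≤ (2 * (C + D) * ‖ξ‖) ^ 2 := by
          have h1 : 0 ≤ C * ‖ξ‖ := by positivity
          have h2 : 0 ≤ D * ‖ξ‖ := by positivity
          have h3 : 2 * (C + D) * ‖ξ‖ = 2 * (C * ‖ξ‖ + D * ‖ξ‖) := by ring
          rw [h3]
          nlinarith [mul_nonneg h1 h2]
  | hbis f S hS hf =>
    obtain ⟨hSc, hSo, hSr, hSd⟩ := mem_compactOpenBisections.1 hS
    obtain ⟨C, hC⟩ := f.hasCompactSupport.exists_bound_of_continuous (map_continuous f)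
    refine ⟨|C|, abs_nonneg _, fun ξ F => ?_⟩
    let F' := F.filter fun g => ∃ h ∈ S, rng h = rng g
    have h0 : ∑ g ∈ F, ‖conv f ξ g‖ ^ 2 = ∑ g ∈ F', ‖conv f ξ g‖ ^ 2 := by
      rw [Finset.sum_filter_of_ne]
      intro g _ hg
      by_contra h
      exact hg (by rw [conv_of_notMem hf _ fun h' hh e => h ⟨h', hh, e⟩]; simp)
    rw [h0]
    have hex : ∀ g : G, ∃ k : G, (∃ h ∈ S, rng h = rng g) →
        ∃ h ∈ S, rng h = rng g ∧ k = h⁻¹ * g := by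
      intro g
      by_cases h : ∃ h ∈ S, rng h = rng g
      · obtain ⟨h, hh, e⟩ := h
        exact ⟨h⁻¹ * g, fun _ => ⟨h, hh, e, rfl⟩⟩
      · exact ⟨g, fun h' => absurd h' h⟩
    choose t ht using hex
    have hinj : InjOn t F' := by
      intro x hx y hy hxy
      obtain ⟨h, hh, e, ek⟩ := ht x (Finset.mem_filter.1 hx).2
      obtain ⟨h', hh', e', ek'⟩ := ht y (Finset.mem_filter.1 hy).2
      have hd : dom h = dom h' := by
        rw [← rng_inv h, ← rng_inv h', ← rng_mul (composable_inv_mul_of_rng e),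
          ← rng_mul (composable_inv_mul_of_rng e'), ← ek, ← ek', hxy]
      obtain rfl := hSd hh hh' hd
      rw [← mul_inv_mul_cancel e, ← mul_inv_mul_cancel e', ← ek, ← ek', hxy]
    have hξ : ∑ k ∈ F'.image t, ‖ξ k‖ ^ 2 ≤ ‖ξ‖ ^ 2 := by
      have := lp.sum_rpow_le_norm_rpow (p := 2) (by norm_num) ξ (F'.image t)
      simpa using this
    rw [Finset.sum_image hinj] at hξ
    calc ∑ g ∈ F', ‖conv f ξ g‖ ^ 2 ≤ ∑ g ∈ F', |C| ^ 2 * ‖ξ (t g)‖ ^ 2 := by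
          refine Finset.sum_le_sum fun g hg => ?_
          obtain ⟨h, hh, e, ek⟩ := ht g (Finset.mem_filter.1 hg).2
          rw [conv_of_mem hSr hf _ hh e, ← ek, norm_mul, mul_pow]
          gcongr
          exact (hC h).trans (le_abs_self C)
      _ ≤ |C| ^ 2 * ‖ξ‖ ^ 2 := by
          rw [← Finset.mul_sum]
          gcongr
      _ = (|C| * ‖ξ‖) ^ 2 := by ring

theorem memlp_conv (f : CompactlySupportedContinuousMap G ℂ) (ξ : lp (fun _ : G => ℂ) 2) :
    Memℓp (conv f ξ) 2 := by
  obtain ⟨C, -, h⟩ := exists_conv_bound f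
  exact memℓp_gen' (C := (C * ‖ξ‖) ^ 2) fun F => by simpa using h ξ F

/-- The operator `ξ ↦ f ∗ ξ` on `ℓ²(G)`, for `f ∈ C_c(G)`. Since `G` is the disjoint union of the
fibres `G_u = d⁻¹(u)`, `u ∈ G⁽⁰⁾`, the Hilbert space `ℓ²(G)` is the orthogonal direct sum of the
`ℓ²(G_u)`, and this operator is the direct sum of the regular representations `π_u(f)`; in
particular its norm is `sup_u ‖π_u(f)‖`, the reduced norm of `f`. -/
noncomputable def regularRep (f : CompactlySupportedContinuousMap G ℂ) :
    lp (fun _ : G => ℂ) 2 →L[ℂ] lp (fun _ : G => ℂ) 2 :=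
  LinearMap.mkContinuousOfExistsBound
    { toFun := fun ξ => ⟨conv f ξ, memlp_conv f ξ⟩
      map_add' := fun ξ η => lp.ext (conv_add_right f ξ η)
      map_smul' := fun c ξ => lp.ext (conv_smul_right f ξ c) }
    (by
      obtain ⟨C, hC, h⟩ := exists_conv_bound f
      refine ⟨C, fun ξ => ?_⟩
      refine lp.norm_le_of_forall_sum_le (by norm_num) (by positivity) fun F => ?_
      simpa using h ξ F)

theorem regularRep_apply (f : CompactlySupportedContinuousMap G ℂ)
    (ξ : lp (fun _ : G => ℂ) 2) (g : G) : regularRep f ξ g = conv f ξ g := rfl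

theorem regularRep_add (f f' : CompactlySupportedContinuousMap G ℂ) :
    regularRep (f + f') = regularRep f + regularRep f' := by
  refine ContinuousLinearMap.ext fun ξ => lp.ext ?_
  exact conv_add_left f f' ξ

theorem regularRep_smul (c : ℂ) (f : CompactlySupportedContinuousMap G ℂ) :
    regularRep (c • f) = c • regularRep f := by
  refine ContinuousLinearMap.ext fun ξ => lp.ext ?_
  exact conv_smul_left f ξ c

open Classical in
/-- Matrix coefficients of left convolution. -/
theorem regularRep_single (f : CompactlySupportedContinuousMap G ℂ) (x y : G) :
    regularRep f (lp.single 2 y (1 : ℂ)) x = if dom x = dom y then f (x * y⁻¹) else 0 := by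
  rw [regularRep_apply, conv]
  split_ifs with e
  · have c := composable_mul_inv_of_dom e
    have e1 : rng (x * y⁻¹) = rng x := rng_mul c
    have e2 : (x * y⁻¹)⁻¹ * x = y := by
      rw [mul_inv_rev' c, inv_inv', mul_assoc' (composable_iff.2 (by simp [e]))
        (composable_inv_left x)]
      change y * dom x = y
      rw [e, mul_dom_self]
    rw [finsum_eq_single _ (x * y⁻¹), finsum_eq_single _ e1, e2]
    · simp
    · intro h hne; exact absurd rfl hne
    · intro h hne
      refine finsum_cond_zero fun eh => ?_
      rw [lp.single_apply_ne, mul_zero]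
      rintro e3
      apply hne
      rw [← e3, mul_inv_rev' (composable_inv_mul_of_rng eh), inv_inv',
        mul_inv_mul_cancel (g := h) (h := x) eh.symm]
  · refine finsum_fibre_zero fun h eh => ?_
    rw [lp.single_apply_ne, mul_zero]
    rintro rfl
    exact e (dom_mul (composable_inv_mul_of_rng eh)).symm

open Classical in
theorem clm_ext {G : Type*} {S T : lp (fun _ : G => ℂ) 2 →L[ℂ] lp (fun _ : G => ℂ) 2}
    (h : ∀ x y, S (lp.single 2 y (1 : ℂ)) x = T (lp.single 2 y (1 : ℂ)) x) : S = T := by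
  refine lp.ext_continuousLinearMap (by norm_num) fun y => ?_
  refine ContinuousLinearMap.ext_ring (lp.ext (funext fun x => ?_))
  exact h x y

theorem regularRep_ccMul (f₁ f₂ : CompactlySupportedContinuousMap G ℂ) :
    regularRep (ccMul f₁ f₂) = regularRep f₁ * regularRep f₂ := by
  classical
  refine clm_ext fun x y => ?_
  rw [regularRep_single, mul_apply_eq_comp, regularRep_apply f₁]
  have hrow : ∀ h, rng h = rng x → f₁ h * regularRep f₂ (lp.single 2 y (1 : ℂ)) (h⁻¹ * x) =
      if dom x = dom y then f₁ h * f₂ (h⁻¹ * (x * y⁻¹)) else 0 := by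
    intro h e
    have c := composable_inv_mul_of_rng e
    rw [regularRep_single, dom_mul c]
    split_ifs with e'
    · rw [mul_assoc' c (composable_mul_inv_of_dom e')]
    · simp
  rw [conv]
  split_ifs with e
  · change conv f₁ f₂ (x * y⁻¹) = _
    rw [conv, rng_mul (composable_mul_inv_of_dom e)]
    congr! 3 with h eh
    rw [hrow h eh, if_pos e]
  · refine (finsum_fibre_zero fun h eh => ?_).symm
    rw [hrow h eh, if_neg e]

theorem regularRep_ccStar (f : CompactlySupportedContinuousMap G ℂ) :
    regularRep (ccStar f) = star (regularRep f) := by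
  classical
  refine clm_ext fun x y => ?_
  rw [ContinuousLinearMap.star_eq_adjoint]
  have h1 := lp.inner_single_left (𝕜 := ℂ) (G := fun _ : G => ℂ) x (1 : ℂ)
    (ContinuousLinearMap.adjoint (regularRep f) (lp.single 2 y (1 : ℂ)))
  rw [ContinuousLinearMap.adjoint_inner_right, lp.inner_single_right] at h1
  simp only [RCLike.inner_apply, map_one, mul_one, one_mul] at h1
  rw [← h1, regularRep_single, regularRep_single]
  by_cases e : dom x = dom y
  · rw [if_pos e, if_pos e.symm]
    change star (f (x * y⁻¹)⁻¹) = _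
    rw [mul_inv_rev' (composable_mul_inv_of_dom e), inv_inv']
    rfl
  · rw [if_neg e, if_neg (Ne.symm e), map_zero]

theorem regularRep_ccOne [CompactSpace (units G)] : regularRep (ccOne G) = 1 := by
  refine ContinuousLinearMap.ext fun ξ => lp.ext (funext fun x => ?_)
  rw [regularRep_apply, conv_of_mem (S := units G) (h := rng x)
    (mem_compactOpenBisections.1 (units_mem_compactOpenBisections G)).2.2.1
    (fun y hy => by change (units G).indicator (1 : G → ℂ) y = 0; simp [hy]) ξ (rng_mem_units x) (rng_rng x),
    inv_of_unit (rng_mem_units x), rng_mul_self]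
  have : ccOne G (rng x) = 1 := by
    change (units G).indicator (1 : G → ℂ) (rng x) = _
    simp [rng_mem_units x]
  rw [this, one_mul]
  rfl

variable (G) in
/-- The image of the `*`-algebra `C_c(G)` in `B(ℓ²(G))`, for a compact unit space. -/
noncomputable def regularRepRange [CompactSpace (units G)] :
    StarSubalgebra ℂ (lp (fun _ : G => ℂ) 2 →L[ℂ] lp (fun _ : G => ℂ) 2) where
  carrier := Set.range regularRep
  mul_mem' := by
    rintro _ _ ⟨f, rfl⟩ ⟨g, rfl⟩
    exact ⟨ccMul f g, regularRep_ccMul f g⟩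
  add_mem' := by
    rintro _ _ ⟨f, rfl⟩ ⟨g, rfl⟩
    exact ⟨f + g, regularRep_add f g⟩
  algebraMap_mem' c := ⟨c • ccOne G, by
    rw [regularRep_smul, regularRep_ccOne, Algebra.algebraMap_eq_smul_one]⟩
  star_mem' := by
    rintro _ ⟨f, rfl⟩
    exact ⟨ccStar f, regularRep_ccStar f⟩

variable (G) in
/-- The reduced groupoid C*-algebra `C_r^*(G)`, for a compact unit space: the completion of
`C_c(G)` in the reduced norm, realised as the norm closure of the image of `C_c(G)` in
`B(ℓ²(G)) = B(⨁_u ℓ²(G_u))`. -/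
noncomputable def reducedCStarAlgebra [CompactSpace (units G)] :
    StarSubalgebra ℂ (lp (fun _ : G => ℂ) 2 →L[ℂ] lp (fun _ : G => ℂ) 2) :=
  (regularRepRange G).topologicalClosure

end AlgGroupoid

/-! Traces and finiteness for unital `*`-algebras -/

/-- A faithful tracial state on a unital C*-algebra: a positive linear functional with `τ(1) = 1`
and `τ(ab) = τ(ba)` that vanishes on `a*a` only if `a = 0`. -/
structure IsFaithfulTracialState {A : Type*} [Ring A] [StarRing A] [Algebra ℂ A]
    (τ : A →ₗ[ℂ] ℂ) : Prop where
  nonneg_re : ∀ a : A, 0 ≤ (τ (star a * a)).re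
  im_eq_zero : ∀ a : A, (τ (star a * a)).im = 0
  map_one : τ 1 = 1
  trace : ∀ a b : A, τ (a * b) = τ (b * a)
  faithful : ∀ a : A, τ (star a * a) = 0 → a = 0

/-- A projection `p` is finite if it is not Murray-von Neumann equivalent to a proper
subprojection `q < p`. -/
def IsFiniteProjection {A : Type*} [Ring A] [StarRing A] (p : A) : Prop :=
  IsStarProjection p ∧ ∀ q v : A, IsStarProjection q → q * p = q → star v * v = p → v * star v = q →
    q = p

/-- A unital C*-algebra `A` is stably finite if for all `n` the unit of `M_n(A)` is a finite
projection. -/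
def IsStablyFinite (A : Type*) [Ring A] [StarRing A] : Prop :=
  ∀ n : ℕ, IsFiniteProjection (1 : Matrix (Fin n) (Fin n) A)

namespace AlgGroupoid

section Paradoxical

variable {G : Type*} [AlgGroupoid G]

/-- `(𝔼, k, l)`-paradoxical subsets of the unit space, for a family `𝔼` of bisections and
`k > l > 0`. -/
def IsParadoxical (𝔼 : Set (Set G)) (k l : ℕ) (A : Set G) : Prop :=
  0 < l ∧ l < k ∧ A.Nonempty ∧
    ∃ (n : Fin k → ℕ) (V : ∀ i, Fin (n i) → Set G) (m : ∀ i, Fin (n i) → Fin l),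
      (∀ i j, V i j ∈ 𝔼) ∧
      (∀ i, ⋃ j, dom '' V i j = A) ∧
      (∀ i j, rng '' V i j ⊆ A) ∧
      Pairwise fun x y : Σ i, Fin (n i) =>
        Disjoint ((rng '' V x.1 x.2) ×ˢ {m x.1 x.2}) ((rng '' V y.1 y.2) ×ˢ {m y.1 y.2})

/-- `A` is completely `𝔼`-non-paradoxical. -/
def IsCompletelyNonParadoxical (𝔼 : Set (Set G)) (A : Set G) : Prop :=
  ∀ k l : ℕ, 0 < l → l < k → ¬ IsParadoxical 𝔼 k l A

end Paradoxical

section TypeSemigroup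

variable (G : Type*) [AlgGroupoid G] [TopologicalSpace G]

/-- The compact open subsets of the unit space. -/
def CompactOpenUnits : Type _ := {A : Set G // A ∈ compactOpenBisections G ∧ A ⊆ units G}

variable {G}

/-- A finite sequence `A₁, …, Aₙ` of compact open subsets of the unit space stands for the set
`⋃ᵢ Aᵢ × {i}` (with indices starting at `0`). -/
def levelSet (L : List (CompactOpenUnits G)) : Set (G × ℕ) :=
  ⋃ i : Fin L.length, (L.get i).1 ×ˢ {(i : ℕ)}

/-- The relation `⋃ᵢ Aᵢ × {i} ∼ ⋃ⱼ Bⱼ × {j}`: there are compact open bisections `W₁, …, W_l` and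
numbers `n_k`, `m_k` such that the two sets are the disjoint unions of the `d(W_k) × {n_k}` and of
the `r(W_k) × {m_k}`, respectively. -/
def TypeEquiv (L M : List (CompactOpenUnits G)) : Prop :=
  ∃ (l : ℕ) (W : Fin l → Set G) (n m : Fin l → ℕ),
    (∀ k, W k ∈ compactOpenBisections G) ∧
    levelSet L = ⋃ k, (dom '' W k) ×ˢ {n k} ∧
    (Pairwise fun k k' => Disjoint ((dom '' W k) ×ˢ {n k}) ((dom '' W k') ×ˢ {n k'})) ∧
    levelSet M = ⋃ k, (rng '' W k) ×ˢ {m k} ∧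
    (Pairwise fun k k' => Disjoint ((rng '' W k) ×ˢ {m k}) ((rng '' W k') ×ˢ {m k'}))

theorem mem_levelSet {L : List (CompactOpenUnits G)} {p : G × ℕ} :
    p ∈ levelSet L ↔ ∃ h : p.2 < L.length, p.1 ∈ L[p.2].1 := by
  simp only [levelSet, mem_iUnion, mem_prod, mem_singleton_iff]
  constructor
  · rintro ⟨i, h1, h2⟩
    obtain ⟨x, j⟩ := p
    obtain rfl : j = i := h2
    exact ⟨i.2, h1⟩
  · rintro ⟨h, h1⟩
    exact ⟨⟨p.2, h⟩, h1, rfl⟩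

/-- A pointwise form of the relation, with an arbitrary finite index type. -/
theorem TypeEquiv.of_pointwise {L M : List (CompactOpenUnits G)} {ι : Type*} [Finite ι]
    (W : ι → Set G) (n m : ι → ℕ) (hW : ∀ k, W k ∈ compactOpenBisections G)
    (h1 : ∀ k, ∀ w ∈ W k, (dom w, n k) ∈ levelSet L)
    (h2 : ∀ p ∈ levelSet L, ∃ k, ∃ w ∈ W k, dom w = p.1 ∧ n k = p.2)
    (h3 : ∀ k k', ∀ w ∈ W k, ∀ w' ∈ W k', dom w = dom w' → n k = n k' → k = k')
    (h4 : ∀ k, ∀ w ∈ W k, (rng w, m k) ∈ levelSet M)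
    (h5 : ∀ p ∈ levelSet M, ∃ k, ∃ w ∈ W k, rng w = p.1 ∧ m k = p.2)
    (h6 : ∀ k k', ∀ w ∈ W k, ∀ w' ∈ W k', rng w = rng w' → m k = m k' → k = k') :
    TypeEquiv L M := by
  obtain ⟨l, ⟨e⟩⟩ := Finite.exists_equiv_fin ι
  have key : ∀ (f : G → G) (X : Set (G × ℕ)) (a : ι → ℕ),
      (∀ k, ∀ w ∈ W k, (f w, a k) ∈ X) →
      (∀ p ∈ X, ∃ k, ∃ w ∈ W k, f w = p.1 ∧ a k = p.2) →
      (∀ k k', ∀ w ∈ W k, ∀ w' ∈ W k', f w = f w' → a k = a k' → k = k') →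
      X = ⋃ k : Fin l, (f '' W (e.symm k)) ×ˢ {a (e.symm k)} ∧
      Pairwise fun k k' : Fin l => Disjoint ((f '' W (e.symm k)) ×ˢ {a (e.symm k)})
        ((f '' W (e.symm k')) ×ˢ {a (e.symm k')}) := by
    intro f X a g1 g2 g3
    constructor
    · ext ⟨x, i⟩
      simp only [mem_iUnion, mem_prod, mem_singleton_iff, mem_image]
      constructor
      · intro hp
        obtain ⟨k, w, hw, hx, hi⟩ := g2 _ hp
        exact ⟨e k, ⟨w, by simpa using hw, hx⟩, by simpa using hi.symm⟩
      · rintro ⟨k, ⟨w, hw, rfl⟩, rfl⟩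
        exact g1 _ w hw
    · intro k k' hkk'
      rw [Set.disjoint_left]
      rintro ⟨x, i⟩ ⟨⟨w, hw, hx⟩, hi⟩ ⟨⟨w', hw', hx'⟩, hi'⟩
      exact hkk' (e.symm.injective
        (g3 _ _ w hw w' hw' (hx.trans hx'.symm) (hi.symm.trans hi')))
  obtain ⟨a1, a2⟩ := key dom _ n h1 h2 h3
  obtain ⟨b1, b2⟩ := key rng _ m h4 h5 h6
  exact ⟨l, fun k => W (e.symm k), fun k => n (e.symm k), fun k => m (e.symm k),
    fun k => hW _, a1, a2, b1, b2⟩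

theorem TypeEquiv.pointwise {L M : List (CompactOpenUnits G)} (h : TypeEquiv L M) :
    ∃ (l : ℕ) (W : Fin l → Set G) (n m : Fin l → ℕ), (∀ k, W k ∈ compactOpenBisections G) ∧
    (∀ k, ∀ w ∈ W k, (dom w, n k) ∈ levelSet L) ∧
    (∀ p ∈ levelSet L, ∃ k, ∃ w ∈ W k, dom w = p.1 ∧ n k = p.2) ∧
    (∀ k k', ∀ w ∈ W k, ∀ w' ∈ W k', dom w = dom w' → n k = n k' → k = k') ∧
    (∀ k, ∀ w ∈ W k, (rng w, m k) ∈ levelSet M) ∧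
    (∀ p ∈ levelSet M, ∃ k, ∃ w ∈ W k, rng w = p.1 ∧ m k = p.2) ∧
    (∀ k k', ∀ w ∈ W k, ∀ w' ∈ W k', rng w = rng w' → m k = m k' → k = k') := by
  obtain ⟨l, W, n, m, hW, a1, a2, b1, b2⟩ := h
  have key : ∀ (f : G → G) (X : Set (G × ℕ)) (a : Fin l → ℕ),
      X = ⋃ k, (f '' W k) ×ˢ {a k} →
      (Pairwise fun k k' => Disjoint ((f '' W k) ×ˢ {a k}) ((f '' W k') ×ˢ {a k'})) →
      (∀ k, ∀ w ∈ W k, (f w, a k) ∈ X) ∧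
      (∀ p ∈ X, ∃ k, ∃ w ∈ W k, f w = p.1 ∧ a k = p.2) ∧
      (∀ k k', ∀ w ∈ W k, ∀ w' ∈ W k', f w = f w' → a k = a k' → k = k') := by
    rintro f X a rfl hd
    refine ⟨fun k w hw => mem_iUnion.2 ⟨k, ⟨w, hw, rfl⟩, rfl⟩, ?_, ?_⟩
    · rintro ⟨x, i⟩ hp
      obtain ⟨k, ⟨w, hw, hx⟩, hi⟩ := mem_iUnion.1 hp
      exact ⟨k, w, hw, hx, (mem_singleton_iff.1 hi).symm⟩
    · intro k k' w hw w' hw' e1 e2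
      by_contra hne
      have h1 : (f w, a k) ∈ (f '' W k) ×ˢ {a k} := ⟨⟨w, hw, rfl⟩, rfl⟩
      have h2 : (f w, a k) ∈ (f '' W k') ×ˢ {a k'} := ⟨⟨w', hw', e1.symm⟩, e2⟩
      exact Set.disjoint_left.1 (hd hne) h1 h2
  obtain ⟨c1, c2, c3⟩ := key dom _ n a1 a2
  obtain ⟨d1, d2, d3⟩ := key rng _ m b1 b2
  exact ⟨l, W, n, m, hW, c1, c2, c3, d1, d2, d3⟩

/-- Rearranging the members of a sequence does not change its class. -/
theorem TypeEquiv.of_perm {L M : List (CompactOpenUnits G)}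
    (σ : Fin L.length ≃ Fin M.length) (hσ : ∀ i, M.get (σ i) = L.get i) : TypeEquiv L M := by
  refine .of_pointwise (ι := Fin L.length) (fun i => (L.get i).1) (fun i => i) (fun i => σ i)
    (fun i => (L.get i).2.1) ?_ ?_ ?_ ?_ ?_ ?_
  · intro k w hw
    rw [dom_of_unit ((L.get k).2.2 hw)]
    exact mem_levelSet.2 ⟨k.2, hw⟩
  · rintro ⟨x, i⟩ hp
    obtain ⟨h, hx⟩ := mem_levelSet.1 hp
    exact ⟨⟨i, h⟩, x, hx, dom_of_unit ((L.get ⟨i, h⟩).2.2 hx), rfl⟩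
  · intro k k' w _ w' _ _ e
    exact Fin.ext e
  · intro k w hw
    rw [rng_of_unit ((L.get k).2.2 hw)]
    refine mem_levelSet.2 ⟨(σ k).2, ?_⟩
    have := hσ k
    rw [List.get_eq_getElem] at this
    rw [this]
    exact hw
  · rintro ⟨x, i⟩ hp
    obtain ⟨h, hx⟩ := mem_levelSet.1 hp
    have h' := hσ (σ.symm ⟨i, h⟩)
    rw [Equiv.apply_symm_apply] at h'
    have hx' : x ∈ (L.get (σ.symm ⟨i, h⟩)).1 := by rw [← h']; exact hx
    exact ⟨σ.symm ⟨i, h⟩, x, hx', rng_of_unit ((L.get _).2.2 hx'), by simp⟩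
  · intro k k' w _ w' _ _ e
    exact σ.injective (Fin.ext e)

theorem TypeEquiv.refl (L : List (CompactOpenUnits G)) : TypeEquiv L L :=
  .of_perm (Equiv.refl _) fun _ => rfl

theorem TypeEquiv.symm [IsAmpleGroupoid G] {L M : List (CompactOpenUnits G)}
    (h : TypeEquiv L M) : TypeEquiv M L := by
  obtain ⟨l, W, n, m, hW, a1, a2, a3, b1, b2, b3⟩ := h.pointwise
  refine .of_pointwise (fun k => {x : G | x⁻¹ ∈ W k}) m n
    (fun k => inv_mem_compactOpenBisections (hW k)) ?_ ?_ ?_ ?_ ?_ ?_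
  · intro k w hw
    simpa using b1 k _ hw
  · intro p hp
    obtain ⟨k, w, hw, e⟩ := b2 p hp
    exact ⟨k, w⁻¹, by simpa [inv_inv'] using hw, by simpa using e⟩
  · intro k k' w hw w' hw' e e'
    exact b3 k k' _ hw _ hw' (by simpa using e) e'
  · intro k w hw
    simpa using a1 k _ hw
  · intro p hp
    obtain ⟨k, w, hw, e⟩ := a2 p hp
    exact ⟨k, w⁻¹, by simpa [inv_inv'] using hw, by simpa using e⟩
  · intro k k' w hw w' hw' e e'
    exact a3 k k' _ hw _ hw' (by simpa using e) e'

theorem TypeEquiv.trans [IsAmpleGroupoid G] [T2Space G] {L M N : List (CompactOpenUnits G)}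
    (h : TypeEquiv L M) (h' : TypeEquiv M N) : TypeEquiv L N := by
  obtain ⟨l, W, n, m, hW, a1, a2, a3, b1, b2, b3⟩ := h.pointwise
  obtain ⟨l', V, n', m', hV, c1, c2, c3, d1, d2, d3⟩ := h'.pointwise
  refine .of_pointwise (ι := {q : Fin l × Fin l' // m q.1 = n' q.2})
    (fun q => {x : G | ∃ v ∈ V q.1.2, ∃ w ∈ W q.1.1, dom v = rng w ∧ x = v * w})
    (fun q => n q.1.1) (fun q => m' q.1.2)
    (fun q => mul_mem_compactOpenBisections (hV _) (hW _)) ?_ ?_ ?_ ?_ ?_ ?_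
  · rintro ⟨⟨i, j⟩, hq⟩ _ ⟨v, hv, w, hw, e, rfl⟩
    rw [dom_mul (composable_iff.2 e)]
    exact a1 i w hw
  · intro p hp
    obtain ⟨i, w, hw, e1, e2⟩ := a2 p hp
    obtain ⟨j, v, hv, e3, e4⟩ := c2 _ (b1 i w hw)
    exact ⟨⟨(i, j), e4.symm⟩, v * w, ⟨v, hv, w, hw, e3, rfl⟩,
      (dom_mul (composable_iff.2 e3)).trans e1, e2⟩
  · rintro ⟨⟨i, j⟩, hq⟩ ⟨⟨i', j'⟩, hq'⟩ _ ⟨v, hv, w, hw, e, rfl⟩ _ ⟨v', hv', w', hw', e', rfl⟩ g1 g2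
    rw [dom_mul (composable_iff.2 e), dom_mul (composable_iff.2 e')] at g1
    obtain rfl : i = i' := a3 i i' w hw w' hw' g1 g2
    obtain rfl : w = w' := injOn_iff_injective.2 (hW i).2.2.2.injective hw hw' g1
    obtain rfl : j = j' := c3 j j' v hv v' hv' (e.trans e'.symm) (hq.symm.trans hq')
    rfl
  · rintro ⟨⟨i, j⟩, hq⟩ _ ⟨v, hv, w, hw, e, rfl⟩
    rw [rng_mul (composable_iff.2 e)]
    exact d1 j v hv
  · intro p hp
    obtain ⟨j, v, hv, e1, e2⟩ := d2 p hp
    obtain ⟨i, w, hw, e3, e4⟩ := b2 _ (c1 j v hv)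
    exact ⟨⟨(i, j), e4⟩, v * w, ⟨v, hv, w, hw, e3.symm, rfl⟩,
      (rng_mul (composable_iff.2 e3.symm)).trans e1, e2⟩
  · rintro ⟨⟨i, j⟩, hq⟩ ⟨⟨i', j'⟩, hq'⟩ _ ⟨v, hv, w, hw, e, rfl⟩ _ ⟨v', hv', w', hw', e', rfl⟩ g1 g2
    rw [rng_mul (composable_iff.2 e), rng_mul (composable_iff.2 e')] at g1
    obtain rfl : j = j' := d3 j j' v hv v' hv' g1 g2
    obtain rfl : v = v' := injOn_iff_injective.2 (hV j).2.2.1.injective hv hv' g1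
    obtain rfl : i = i' := b3 i i' w hw w' hw' (e.symm.trans e') (hq.trans hq'.symm)
    rfl

theorem mem_levelSet_append {L M : List (CompactOpenUnits G)} {p : G × ℕ} :
    p ∈ levelSet (L ++ M) ↔
      p ∈ levelSet L ∨ ∃ i, p.2 = i + L.length ∧ (p.1, i) ∈ levelSet M := by
  simp only [mem_levelSet, List.length_append]
  constructor
  · rintro ⟨h, hx⟩
    by_cases h' : p.2 < L.length
    · rw [List.getElem_append_left h'] at hx
      exact Or.inl ⟨h', hx⟩
    · rw [List.getElem_append_right (by omega)] at hx
      exact Or.inr ⟨p.2 - L.length, by omega, by omega, hx⟩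
  · rintro (⟨h, hx⟩ | ⟨i, hi, h, hx⟩)
    · exact ⟨by omega, by rwa [List.getElem_append_left h]⟩
    · refine ⟨by omega, ?_⟩
      rw [List.getElem_append_right (by omega)]
      simpa [hi] using hx

theorem TypeEquiv.append {L L' M M' : List (CompactOpenUnits G)}
    (h : TypeEquiv L L') (h' : TypeEquiv M M') : TypeEquiv (L ++ M) (L' ++ M') := by
  obtain ⟨l, W, n, m, hW, a1, a2, a3, b1, b2, b3⟩ := h.pointwise
  obtain ⟨l', V, n', m', hV, c1, c2, c3, d1, d2, d3⟩ := h'.pointwise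
  have lt : ∀ {L : List (CompactOpenUnits G)} {x : G} {i : ℕ}, (x, i) ∈ levelSet L → i < L.length :=
    fun h => (mem_levelSet.1 h).1
  refine .of_pointwise (ι := Fin l ⊕ Fin l') (Sum.elim W V)
    (Sum.elim n fun k => n' k + L.length) (Sum.elim m fun k => m' k + L'.length)
    (by rintro (k | k); exacts [hW k, hV k]) ?_ ?_ ?_ ?_ ?_ ?_
  · rintro (k | k) w hw
    · exact mem_levelSet_append.2 (Or.inl (a1 k w hw))
    · exact mem_levelSet_append.2 (Or.inr ⟨_, rfl, c1 k w hw⟩)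
  · intro p hp
    rcases mem_levelSet_append.1 hp with hp | ⟨i, hi, hp⟩
    · obtain ⟨k, w, hw, e⟩ := a2 p hp
      exact ⟨Sum.inl k, w, hw, e⟩
    · obtain ⟨k, w, hw, e1, e2⟩ := c2 _ hp
      exact ⟨Sum.inr k, w, hw, e1, by simp [e2, hi]⟩
  · rintro (k | k) (k' | k') w hw w' hw' e1 e2
    · exact congrArg _ (a3 k k' w hw w' hw' e1 e2)
    · have := lt (a1 k w hw)
      simp only [Sum.elim_inl, Sum.elim_inr] at e2
      omega
    · have := lt (a1 k' w' hw')
      simp only [Sum.elim_inl, Sum.elim_inr] at e2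
      omega
    · exact congrArg _ (c3 k k' w hw w' hw' e1 (by simpa using e2))
  · rintro (k | k) w hw
    · exact mem_levelSet_append.2 (Or.inl (b1 k w hw))
    · exact mem_levelSet_append.2 (Or.inr ⟨_, rfl, d1 k w hw⟩)
  · intro p hp
    rcases mem_levelSet_append.1 hp with hp | ⟨i, hi, hp⟩
    · obtain ⟨k, w, hw, e⟩ := b2 p hp
      exact ⟨Sum.inl k, w, hw, e⟩
    · obtain ⟨k, w, hw, e1, e2⟩ := d2 _ hp
      exact ⟨Sum.inr k, w, hw, e1, by simp [e2, hi]⟩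
  · rintro (k | k) (k' | k') w hw w' hw' e1 e2
    · exact congrArg _ (b3 k k' w hw w' hw' e1 e2)
    · have := lt (b1 k w hw)
      simp only [Sum.elim_inl, Sum.elim_inr] at e2
      omega
    · have := lt (b1 k' w' hw')
      simp only [Sum.elim_inl, Sum.elim_inr] at e2
      omega
    · exact congrArg _ (d3 k k' w hw w' hw' e1 (by simpa using e2))

theorem TypeEquiv.append_comm (L M : List (CompactOpenUnits G)) :
    TypeEquiv (L ++ M) (M ++ L) := by
  refine .of_perm ((finCongr List.length_append).trans
    ((finAddFlip (m := L.length) (n := M.length)).trans (finCongr List.length_append.symm))) ?_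
  rintro ⟨i, hi⟩
  simp only [List.length_append] at hi
  by_cases h : i < L.length
  · simp [finAddFlip_apply_mk_left h, List.getElem_append_right, List.getElem_append_left h]
  · push Not at h
    have hl : i - L.length < M.length := by omega
    simp [finAddFlip_apply_mk_right h hi, List.getElem_append_right h,
      List.getElem_append_left hl]

variable (G) in
/-- The equivalence relation `∼`. -/
abbrev typeSetoid [IsAmpleGroupoid G] [T2Space G] : Setoid (List (CompactOpenUnits G)) where
  r := TypeEquiv
  iseqv := ⟨TypeEquiv.refl, TypeEquiv.symm, TypeEquiv.trans⟩

variable (G) in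
/-- The type semigroup `S(G, Gᵃ)`. -/
def TypeSemigroup [IsAmpleGroupoid G] [T2Space G] : Type _ := Quotient (typeSetoid G)

variable [IsAmpleGroupoid G] [T2Space G]

/-- Addition is juxtaposition of sequences,
`[⋃ᵢ Aᵢ × {i}] + [⋃ⱼ Bⱼ × {j}] = [⋃ᵢ Aᵢ × {i} ∪ ⋃ⱼ Bⱼ × {n + j}]`. -/
instance : Add (TypeSemigroup G) where
  add := Quotient.map₂ (· ++ ·) fun _ _ h _ _ h' => TypeEquiv.append h h'

instance : Zero (TypeSemigroup G) where
  zero := Quotient.mk (typeSetoid G) []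

instance : AddCommMonoid (TypeSemigroup G) where
  add_assoc := by
    rintro ⟨a⟩ ⟨b⟩ ⟨c⟩
    exact congrArg (Quotient.mk (typeSetoid G)) (List.append_assoc a b c)
  zero_add := by
    rintro ⟨a⟩
    rfl
  add_zero := by
    rintro ⟨a⟩
    exact congrArg (Quotient.mk (typeSetoid G)) (List.append_nil a)
  add_comm := by
    rintro ⟨a⟩ ⟨b⟩
    exact Quotient.sound (s := typeSetoid G) (TypeEquiv.append_comm a b)
  nsmul := nsmulRec

/-- The class `[A]` of a compact open subset of the unit space. -/
def typeClass (A : CompactOpenUnits G) : TypeSemigroup G := Quotient.mk (typeSetoid G) [A]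

variable (G) in
/-- The unit space, as a compact open subset of itself. -/
def unitSpace [CompactSpace (units G)] : CompactOpenUnits G :=
  ⟨units G, units_mem_compactOpenBisections G, subset_rfl⟩

end TypeSemigroup

end AlgGroupoid

/-- A faithful state with finite values on an abelian monoid `S` with its algebraic preorder
(`x ≤ y` if `y = x + z` for some `z`): an additive order preserving map `S → [0, ∞)` with
`φ(0) = 0` that vanishes only at `0`. -/
structure IsFaithfulState {S : Type*} [AddCommMonoid S] (φ : S → NNReal) : Prop where
  map_zero : φ 0 = 0
  map_add : ∀ x y, φ (x + y) = φ x + φ y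
  monotone : ∀ x y, (∃ z, y = x + z) → φ x ≤ φ y
  faithful : ∀ x, φ x = 0 → x = 0

/-! The proof goes round the cycle trace ⇒ stably finite ⇒ non-paradoxical ⇒ state ⇒ trace.

A faithful trace `τ` extends to the faithful trace `τ ∘ Tr` on matrices. It takes the same value on
equivalent projections, so the unit is not equivalent to a proper subprojection
(`IsFaithfulTracialState.isStablyFinite`).

A compact open bisection `V` gives a partial isometry `1_V` with source projection `1_{d(V)}` and
range projection `1_{r(V)}`. A `(k, l)`-paradox packs `k` copies of `A` into `l` copies, and the
corresponding `1_V` form a `k × k` matrix `s` with `s* s = 1_A ⊗ 1` and a zero row. Adding `(1 -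
1_A) ⊗ 1` gives an isometry that is not unitary unless `A` is empty
(`eq_zero_of_isFiniteProjection`, `not_isParadoxical_of_isStablyFinite`).

With `u = [G⁽⁰⁾]`, a relation `n u = (n + 1) u + z` is a paradox of `G⁽⁰⁾`
(`isParadoxical_of_nsmul_eq`). Without such relations the order unit `u` carries a normalised state
(`exists_state_of_orderUnit`): Zorn's lemma gives a minimal monotone sublinear functional, and
minimality forces additivity. Minimality of `G` is what makes the state faithful: every non-empty
compact open `A` has a multiple of its class above `u` (`exists_nsmul_typeClass_eq_add`), so `[A]`
cannot have value `0`.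

A state is finitely additive on the clopen subsets of the profinite space `G⁽⁰⁾`, hence comes from a
Borel probability measure `μ` (`exists_measure_clopens`). It is invariant because `[r(V)] = [d(V)]`,
and has full support because the state is faithful. The trace integrates the diagonal of an operator
against `μ`. The trace property needs checking only on the `1_V`, which span a dense subspace
(`reducedCStarAlgebra_induction`); there it is the invariance of `μ`. Faithfulness holds because the
diagonal entry of `a* a` at a unit `u` is `‖a δ_u‖²`, which is continuous in `u`, and the columns at
units determine `a`. -/

/-! ### States on monoids with an order unit -/

/-- A monotone sublinear functional that is additive in the direction of `u`. -/
structure IsSublinearAlong {S : Type*} [AddCommMonoid S] (u : S) (q : S → ℝ) : Prop where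
  add_le : ∀ x y, q (x + y) ≤ q x + q y
  nsmul : ∀ (n : ℕ) x, q (n • x) = n * q x
  mono : ∀ x z, q x ≤ q (x + z)
  add_unit : ∀ x, q (x + u) = q x + 1

namespace IsSublinearAlong

variable {S : Type*} [AddCommMonoid S] {u : S} {q : S → ℝ}

theorem map_zero (hq : IsSublinearAlong u q) : q 0 = 0 := by
  simpa using hq.nsmul 0 0

theorem nonneg (hq : IsSublinearAlong u q) (x : S) : 0 ≤ q x := by
  have := hq.mono 0 x
  rwa [zero_add, hq.map_zero] at this

/-- Subadditivity is the only condition that needs a chain: for two members of the chain, the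
smaller one bounds the value at `x + y` by the sum of the values of the two at `x` and at `y`. -/
theorem iInf_of_isChain {c : Set (S → ℝ)} (hc : IsChain (· ≤ ·) c) (hne : c.Nonempty)
    (hcu : ∀ q ∈ c, IsSublinearAlong u q) :
    IsSublinearAlong u fun x => ⨅ q : c, q.1 x := by
  have : Nonempty c := hne.to_subtype
  have hb : ∀ x, BddBelow (range fun q : c => q.1 x) := fun x =>
    ⟨0, by rintro _ ⟨q, rfl⟩; exact (hcu _ q.2).nonneg x⟩
  refine ⟨fun x y => le_ciInf_add_ciInf fun f g => ?_, fun n x => ?_, fun x z => ?_, fun x => ?_⟩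
  · rcases hc.total f.2 g.2 with h | h
    · exact (ciInf_le (hb _) f).trans (((hcu _ f.2).add_le x y).trans
        (add_le_add le_rfl (h y)))
    · exact (ciInf_le (hb _) g).trans (((hcu _ g.2).add_le x y).trans
        (add_le_add (h x) le_rfl))
  · rw [Real.mul_iInf_of_nonneg n.cast_nonneg]
    exact congrArg iInf (funext fun q => (hcu _ q.2).nsmul n x)
  · exact ciInf_mono (hb x) fun q => (hcu _ q.2).mono x z
  · apply le_antisymm
    · rw [← sub_le_iff_le_add]
      refine le_ciInf fun q => ?_
      rw [sub_le_iff_le_add, ← (hcu _ q.2).add_unit]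
      exact ciInf_le (hb _) q
    · refine le_ciInf fun q => ?_
      rw [(hcu _ q.2).add_unit]
      exact add_le_add (ciInf_le (hb _) q) le_rfl

/-- The asymptotic increment of a sublinear functional in the direction of `a`. -/
noncomputable def increment (q : S → ℝ) (a x : S) : ℝ := ⨅ n : ℕ, (q (x + n • a) - n * q a)

theorem zero_le_sub (hq : IsSublinearAlong u q) (a x : S) (n : ℕ) :
    0 ≤ q (x + n • a) - n * q a := by
  rw [sub_nonneg, ← hq.nsmul, add_comm]
  exact hq.mono _ _

theorem increment_le (hq : IsSublinearAlong u q) (a x : S) (n : ℕ) :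
    increment q a x ≤ q (x + n • a) - n * q a :=
  ciInf_le ⟨0, by rintro _ ⟨n, rfl⟩; exact hq.zero_le_sub a x n⟩ n

/-- The terms `q (x + n a) - n q(a)` are non-negative and decrease with `n`, so the increment is a
limit along every subsequence of indices. Homogeneity compares the index `n` for `x` with the index
`k n` for `k x`. -/
theorem increment_isSublinearAlong (hq : IsSublinearAlong u q) (a : S) :
    IsSublinearAlong u (increment q a) := by
  refine ⟨fun x y => le_ciInf_add_ciInf fun n m => ?_, fun k x => ?_, fun x z => ?_, fun x => ?_⟩
  · refine (hq.increment_le a _ (n + m)).trans ?_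
    have h := hq.add_le (x + n • a) (y + m • a)
    have e : x + y + (n + m) • a = x + n • a + (y + m • a) := by rw [add_nsmul]; abel
    rw [e]
    push_cast
    linarith
  · have hk : ∀ n, q (k • x + (k * n) • a) - (k * n : ℕ) * q a = k * (q (x + n • a) - n * q a) := by
      intro n
      rw [mul_nsmul', ← nsmul_add, hq.nsmul]
      push_cast
      ring
    apply le_antisymm
    · rw [increment, increment, Real.mul_iInf_of_nonneg k.cast_nonneg]
      refine le_ciInf fun n => ?_
      rw [← hk]
      exact hq.increment_le a _ _
    · refine le_ciInf fun n => ?_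
      -- For positive `k` one splits `k n = n + (k - 1) n` and bounds the second part by
      -- subadditivity; for `k = 0` the bound is just non-negativity.
      rcases Nat.eq_zero_or_pos k with rfl | hpos
      · rw [Nat.cast_zero, zero_mul]
        exact hq.zero_le_sub a (0 • x) n
      refine (mul_le_mul_of_nonneg_left (hq.increment_le a x n) k.cast_nonneg).trans ?_
      rw [← hk]
      obtain ⟨j, rfl⟩ : ∃ j, k = j + 1 := ⟨k - 1, by omega⟩
      have e : (j + 1) • x + ((j + 1) * n) • a = ((j + 1) • x + n • a) + (j * n) • a := by
        module
      have h := hq.add_le ((j + 1) • x + n • a) ((j * n) • a)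
      rw [hq.nsmul] at h
      rw [e]
      push_cast at h ⊢
      linarith
  · refine le_ciInf fun n => (hq.increment_le a x n).trans ?_
    have h := hq.mono (x + n • a) z
    rw [add_right_comm] at h
    linarith
  · have h : ∀ n : ℕ, q (x + u + n • a) = q (x + n • a) + 1 := fun n => by
      rw [add_right_comm, hq.add_unit]
    apply le_antisymm
    · rw [← sub_le_iff_le_add]
      refine le_ciInf fun n => ?_
      have := hq.increment_le a (x + u) n
      rw [h] at this
      linarith
    · refine le_ciInf fun n => ?_
      have := hq.increment_le a x n
      rw [h]
      linarith

/-- The increment in the direction of `y` is at most `q` (take `n = 0`), so by minimality it is also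
at least `q`. Its term `n = 1` then gives `q x ≤ q (x + y) - q y`, the missing half of additivity.
-/
theorem additive_of_minimal (hq : Minimal (IsSublinearAlong u) q) (x y : S) :
    q (x + y) = q x + q y := by
  refine le_antisymm (hq.prop.add_le x y) ?_
  have h1 := hq.prop.increment_isSublinearAlong y
  have h2 : increment q y ≤ q := fun z => by simpa using hq.prop.increment_le y z 0
  have h3 := hq.le_of_le h1 h2 x
  have h4 := hq.prop.increment_le y x 1
  simp only [one_nsmul, Nat.cast_one, one_mul] at h4
  linarith

theorem exists_minimal (h : ∃ q : S → ℝ, IsSublinearAlong u q) :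
    ∃ q : S → ℝ, Minimal (IsSublinearAlong u) q := by
  obtain ⟨q₀, hq₀⟩ := h
  obtain ⟨m, -, hm⟩ := zorn_le_nonempty₀ (α := (S → ℝ)ᵒᵈ)
    (OrderDual.ofDual ⁻¹' {q | IsSublinearAlong u q}) (by
      intro c hcs hc y hy
      have hc' : IsChain (· ≤ ·) (OrderDual.toDual ⁻¹' c : Set (S → ℝ)) := fun a ha b hb hab =>
        (hc ha hb hab).symm
      refine ⟨OrderDual.toDual fun x => ⨅ q : (OrderDual.toDual ⁻¹' c : Set (S → ℝ)), q.1 x,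
        iInf_of_isChain hc' ⟨_, hy⟩ fun q hq => hcs hq, fun z hz x => ?_⟩
      exact ciInf_le (f := fun q : (OrderDual.toDual ⁻¹' c : Set (S → ℝ)) => q.1 x)
        ⟨0, by rintro _ ⟨q, rfl⟩; exact (hcs q.2).nonneg x⟩ ⟨OrderDual.ofDual z, hz⟩)
    (OrderDual.toDual q₀) hq₀
  exact ⟨OrderDual.ofDual m, hm.prop, fun q hq hle => hm.2 (y := OrderDual.toDual q) hq hle⟩

end IsSublinearAlong

/-! ### Normalised states from an order unit -/

section OrderUnit

variable {S : Type*} [AddCommMonoid S]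

/-- The values `(m - k) / n` with `n x + k u ≤ m u`. -/
def majorants (u x : S) : Set ℝ :=
  {v | ∃ n k m : ℕ, ∃ z : S, m • u = (n + 1) • x + k • u + z ∧ v = ((m : ℝ) - k) / (n + 1)}

/-- A negative value means `m < k`, hence `(m + 1) u ≤ m u`. Adding one more `u` makes the
multiplier `m + 1` positive, as the assumption on `u` requires. -/
theorem majorants_nonneg {u : S} (h : ∀ n : ℕ, 0 < n → ∀ z, n • u ≠ (n + 1) • u + z) {x : S}
    {v : ℝ} (hv : v ∈ majorants u x) : 0 ≤ v := by
  obtain ⟨n, k, m, z, e, rfl⟩ := hv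
  refine div_nonneg (sub_nonneg.2 (Nat.cast_le.2 ?_)) (by positivity)
  by_contra! hlt
  obtain ⟨j, rfl⟩ : ∃ j, k = m + 1 + j := ⟨k - (m + 1), by omega⟩
  refine h (m + 1) (by omega) (j • u + (n + 1) • x + z) ?_
  calc (m + 1) • u = m • u + u := succ_nsmul u m
    _ = _ := by rw [e]; module

/-- The functional is the infimum of the majorants: non-empty since `u` is an order unit, bounded
below by `0` since `u` is not paradoxical. -/
theorem exists_isSublinearAlong {u : S} (hu : ∀ x : S, ∃ n : ℕ, ∃ z, n • u = x + z)
    (h : ∀ n : ℕ, 0 < n → ∀ z, n • u ≠ (n + 1) • u + z) :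
    ∃ q : S → ℝ, IsSublinearAlong u q := by
  have hb : ∀ x, BddBelow (majorants u x) := fun x => ⟨0, fun v hv => majorants_nonneg h hv⟩
  have hne : ∀ x, (majorants u x).Nonempty := fun x => by
    obtain ⟨m, z, e⟩ := hu x
    exact ⟨_, 0, 0, m, z, by simpa using e, rfl⟩
  have h0 : ∀ x, 0 ≤ sInf (majorants u x) := fun x =>
    le_csInf (hne x) fun v hv => majorants_nonneg h hv
  refine ⟨fun x => sInf (majorants u x), fun x y => ?_, fun j x => ?_, fun x z => ?_, fun x => ?_⟩
  · rw [← csInf_add (hne x) (hb x) (hne y) (hb y)]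
    refine le_csInf ((hne x).add (hne y)) ?_
    rintro _ ⟨_, ⟨n, k, m, z, e, rfl⟩, _, ⟨n', k', m', z', e', rfl⟩, rfl⟩
    -- The two relations are brought to the common denominator `(n + 1) (n' + 1)`, which is one more
    -- than `n n' + n + n'`.
    refine csInf_le (hb _) ⟨n * n' + n + n', (n' + 1) * k + (n + 1) * k',
      (n' + 1) * m + (n + 1) * m', (n' + 1) • z + (n + 1) • z', ?_, ?_⟩
    · rw [add_nsmul, mul_nsmul', e, mul_nsmul' _ (n + 1) m', e']
      module
    · push_cast
      field_simp
      ring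
  · rcases Nat.eq_zero_or_pos j with rfl | hj
    · simp only [zero_nsmul, Nat.cast_zero, zero_mul]
      refine le_antisymm (csInf_le (hb _) ⟨0, 0, 0, 0, by simp, by simp⟩) (h0 _)
    obtain ⟨i, rfl⟩ : ∃ i, j = i + 1 := ⟨j - 1, by omega⟩
    have hi : (0 : ℝ) < (i + 1 : ℕ) := by positivity
    apply le_antisymm
    · rw [← div_le_iff₀' hi]
      refine le_csInf (hne x) ?_
      rintro _ ⟨n, k, m, z, e, rfl⟩
      rw [div_le_iff₀' hi]
      refine csInf_le (hb _) ⟨n, (i + 1) * k, (i + 1) * m, (i + 1) • z, ?_, ?_⟩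
      · rw [mul_nsmul', e, nsmul_add, nsmul_add, ← mul_nsmul', ← mul_nsmul', ← mul_nsmul',
          mul_comm (n + 1)]
      · push_cast
        field_simp
    · refine le_csInf (hne _) ?_
      rintro _ ⟨n, k, m, z, e, rfl⟩
      rw [← le_div_iff₀' hi]
      refine csInf_le (hb _) ⟨n * i + n + i, k, m, z, ?_, ?_⟩
      · rw [e, ← mul_nsmul']
        congr 3
        ring
      · push_cast
        field_simp
        ring
  · refine le_csInf (hne _) ?_
    rintro _ ⟨n, k, m, w, e, rfl⟩
    refine csInf_le (hb _) ⟨n, k, m, (n + 1) • z + w, ?_, rfl⟩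
    rw [e, nsmul_add]
    abel
  -- Replacing `x` by `x + u` either adds `n + 1` to `m` or, in the other direction, moves `n + 1`
  -- copies of `u` into `k`. The summand `k u` in a majorant serves the second move, since `u` need
  -- not be cancellable.
  · apply le_antisymm
    · rw [← sub_le_iff_le_add]
      refine le_csInf (hne x) ?_
      rintro _ ⟨n, k, m, z, e, rfl⟩
      rw [sub_le_iff_le_add]
      refine csInf_le (hb _) ⟨n, k, m + (n + 1), z, ?_, ?_⟩
      · rw [add_nsmul, e]
        module
      · push_cast
        field_simp
        ring
    · refine le_csInf (hne _) ?_
      rintro _ ⟨n, k, m, z, e, rfl⟩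
      rw [← le_sub_iff_add_le]
      refine csInf_le (hb _) ⟨n, k + (n + 1), m, z, ?_, ?_⟩
      · rw [e]
        module
      · push_cast
        field_simp
        ring

/-- An abelian monoid with an order unit `u` such that `(n + 1) u ≰ n u` for all `n > 0` has a
state that is normalised at `u`. -/
theorem exists_state_of_orderUnit {u : S} (hu : ∀ x : S, ∃ n : ℕ, ∃ z, n • u = x + z)
    (h : ∀ n : ℕ, 0 < n → ∀ z, n • u ≠ (n + 1) • u + z) :
    ∃ φ : S →+ NNReal, φ u = 1 := by
  obtain ⟨q, hq⟩ := IsSublinearAlong.exists_minimal (exists_isSublinearAlong hu h)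
  refine ⟨⟨⟨fun x => ⟨q x, hq.prop.nonneg x⟩, Subtype.ext hq.prop.map_zero⟩, fun x y =>
    Subtype.ext (IsSublinearAlong.additive_of_minimal hq x y)⟩, Subtype.ext ?_⟩
  have := hq.prop.add_unit 0
  rwa [zero_add, hq.prop.map_zero, zero_add] at this

end OrderUnit

/-! ### The type semigroup -/

namespace AlgGroupoid

section TypeClass

variable {G : Type*} [AlgGroupoid G] [TopologicalSpace G]

theorem mem_levelSet_singleton {A : CompactOpenUnits G} {p : G × ℕ} :
    p ∈ levelSet [A] ↔ p.2 = 0 ∧ p.1 ∈ A.1 := by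
  obtain ⟨x, i⟩ := p
  rw [mem_levelSet]
  constructor
  · rintro ⟨h, hx⟩
    obtain rfl : i = 0 := by simpa using h
    exact ⟨rfl, hx⟩
  · rintro ⟨h, hx⟩
    obtain rfl : i = 0 := h
    exact ⟨by simp, hx⟩

theorem mem_levelSet_replicate {A : CompactOpenUnits G} {n : ℕ} {p : G × ℕ} :
    p ∈ levelSet (List.replicate n A) ↔ p.2 < n ∧ p.1 ∈ A.1 := by
  rw [mem_levelSet]
  simp

theorem CompactOpenUnits.isCompact (A : CompactOpenUnits G) : IsCompact A.1 := A.2.1.1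

theorem CompactOpenUnits.isOpen (A : CompactOpenUnits G) : IsOpen A.1 := A.2.1.2.1

theorem CompactOpenUnits.isClosed [T2Space G] (A : CompactOpenUnits G) : IsClosed A.1 :=
  A.isCompact.isClosed

variable [IsAmpleGroupoid G]

theorem inter_mem_compactOpenBisections {V B : Set G} (hV : V ∈ compactOpenBisections G)
    (hB : IsClopen B) : V ∩ B ∈ compactOpenBisections G := by
  obtain ⟨h1, h2, h3, h4⟩ := mem_compactOpenBisections.1 hV
  exact mem_compactOpenBisections.2 ⟨h1.inter_right hB.1, h2.inter hB.2, h3.mono inter_subset_left,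
    h4.mono inter_subset_left⟩

variable [T2Space G]

namespace CompactOpenUnits

/-- A compact open subset of `G` that is contained in the unit space. -/
def of (A : Set G) (hc : IsCompact A) (ho : IsOpen A) (hA : A ⊆ units G) : CompactOpenUnits G :=
  ⟨A, mem_compactOpenBisections_of_subset_units hc ho hA, hA⟩

/-- The relative complement. -/
def diff (A B : CompactOpenUnits G) : CompactOpenUnits G :=
  of (A.1 \ B.1) (A.isCompact.diff B.isOpen) (A.isOpen.sdiff B.isClosed) (sdiff_subset.trans A.2.2)

/-- The range of a compact open bisection. -/
def rngOf (V : Set G) (hV : V ∈ compactOpenBisections G) : CompactOpenUnits G :=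
  of (rng '' V) (hV.1.image continuous_rng) (isOpenMap_rng V hV.2.1)
    (by rintro _ ⟨g, -, rfl⟩; exact rng_mem_units g)

/-- The domain of a compact open bisection. -/
def domOf (V : Set G) (hV : V ∈ compactOpenBisections G) : CompactOpenUnits G :=
  of (dom '' V) (hV.1.image continuous_dom) (isOpenMap_dom V hV.2.1)
    (by rintro _ ⟨g, -, rfl⟩; exact dom_mem_units g)

end CompactOpenUnits

open CompactOpenUnits

theorem typeClass_rngOf {V : Set G} (hV : V ∈ compactOpenBisections G) :
    typeClass (rngOf V hV) = typeClass (domOf V hV) := by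
  refine (Quotient.sound (s := typeSetoid G) ?_).symm
  refine .of_pointwise (ι := Unit) (fun _ => V) (fun _ => 0) (fun _ => 0) (fun _ => hV) ?_ ?_ ?_ ?_ ?_ ?_
  · exact fun _ w hw => mem_levelSet_singleton.2 ⟨rfl, w, hw, rfl⟩
  · rintro ⟨x, i⟩ hp
    obtain ⟨hi, w, hw, e⟩ := mem_levelSet_singleton.1 hp
    exact ⟨(), w, hw, e, hi.symm⟩
  · exact fun _ _ _ _ _ _ _ _ => rfl
  · exact fun _ w hw => mem_levelSet_singleton.2 ⟨rfl, w, hw, rfl⟩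
  · rintro ⟨x, i⟩ hp
    obtain ⟨hi, w, hw, e⟩ := mem_levelSet_singleton.1 hp
    exact ⟨(), w, hw, e, hi.symm⟩
  · exact fun _ _ _ _ _ _ _ _ => rfl

/-- `A` and `B` are themselves bisections consisting of units; they carry the levels `0` and `1` of
the juxtaposition onto the single level of `C`. -/
theorem typeClass_union {A B C : CompactOpenUnits G} (hd : Disjoint A.1 B.1)
    (hC : C.1 = A.1 ∪ B.1) : typeClass C = typeClass A + typeClass B := by
  refine (Quotient.sound (s := typeSetoid G) (a := [A] ++ [B]) (b := [C]) ?_).symm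
  have hmem : ∀ p : G × ℕ, p ∈ levelSet ([A] ++ [B]) ↔
      (p.2 = 0 ∧ p.1 ∈ A.1) ∨ (p.2 = 1 ∧ p.1 ∈ B.1) := by
    rintro ⟨x, i⟩
    rw [mem_levelSet_append, mem_levelSet_singleton]
    refine or_congr Iff.rfl ?_
    simp only [mem_levelSet_singleton, List.length_singleton]
    constructor
    · rintro ⟨j, h1, h2, h3⟩
      exact ⟨by omega, h3⟩
    · rintro ⟨h1, h2⟩
      exact ⟨0, by omega, rfl, h2⟩
  let D : Bool → CompactOpenUnits G := fun b => cond b B A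
  have hDC : ∀ b, (D b).1 ⊆ C.1 := by
    rw [hC]
    rintro (_ | _)
    exacts [subset_union_left, subset_union_right]
  refine .of_pointwise (ι := Bool) (fun b => (D b).1) (fun b => cond b 1 0) (fun _ => 0)
    (fun b => (D b).2.1) ?_ ?_ ?_ ?_ ?_ ?_
  · rintro (_ | _) w hw <;> rw [hmem, dom_of_unit ((D _).2.2 hw)]
    exacts [Or.inl ⟨rfl, hw⟩, Or.inr ⟨rfl, hw⟩]
  · intro p hp
    rcases (hmem p).1 hp with ⟨h1, h2⟩ | ⟨h1, h2⟩
    · exact ⟨false, _, h2, dom_of_unit (A.2.2 h2), h1.symm⟩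
    · exact ⟨true, _, h2, dom_of_unit (B.2.2 h2), h1.symm⟩
  · rintro (_ | _) (_ | _) w _ w' _ _ e <;> simp_all
  · intro b w hw
    rw [rng_of_unit ((D _).2.2 hw)]
    exact mem_levelSet_singleton.2 ⟨rfl, hDC b hw⟩
  · intro p hp
    obtain ⟨h1, h2⟩ := mem_levelSet_singleton.1 hp
    rw [hC] at h2
    rcases h2 with h2 | h2
    · exact ⟨false, _, h2, rng_of_unit (A.2.2 h2), h1.symm⟩
    · exact ⟨true, _, h2, rng_of_unit (B.2.2 h2), h1.symm⟩
  · have key : ∀ w ∈ A.1, ∀ w' ∈ B.1, w ≠ w' := by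
      rintro w hw _ hw' rfl
      exact Set.disjoint_left.1 hd hw hw'
    rintro b b' w hw w' hw' e -
    rw [rng_of_unit ((D _).2.2 hw), rng_of_unit ((D _).2.2 hw')] at e
    rcases b with _ | _ <;> rcases b' with _ | _
    · rfl
    · exact absurd e (key w hw w' hw')
    · exact absurd e.symm (key w' hw' w hw)
    · rfl

theorem typeClass_add_diff {A B : CompactOpenUnits G} (h : A.1 ⊆ B.1) :
    typeClass B = typeClass A + typeClass (B.diff A) :=
  typeClass_union disjoint_sdiff_right (union_sdiff_cancel h).symm

theorem eq_empty_of_typeClass_eq_zero {A : CompactOpenUnits G} (h : typeClass A = 0) :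
    A.1 = ∅ := by
  obtain ⟨l, W, n, m, hW, a1, a2, a3, b1, b2, b3⟩ :=
    TypeEquiv.pointwise (Quotient.exact (s := typeSetoid G) h)
  rw [Set.eq_empty_iff_forall_notMem]
  intro x hx
  obtain ⟨k, w, hw, -⟩ := a2 (x, 0) (mem_levelSet_singleton.2 ⟨rfl, hx⟩)
  have := (mem_levelSet.1 (b1 k w hw)).1
  simp at this

theorem typeClass_eq_zero {A : CompactOpenUnits G} (h : A.1 = ∅) : typeClass A = 0 := by
  refine Quotient.sound (s := typeSetoid G) ?_
  have h1 : ∀ p, p ∉ levelSet [A] := fun p hp => by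
    have := (mem_levelSet_singleton.1 hp).2
    rw [h] at this
    exact this
  have h2 : ∀ p : G × ℕ, p ∉ levelSet ([] : List (CompactOpenUnits G)) := fun p hp => by
    have := (mem_levelSet.1 hp).1
    simp at this
  exact .of_pointwise (ι := Empty) Empty.elim Empty.elim Empty.elim (fun k => k.elim)
    (fun k => k.elim) (fun p hp => absurd hp (h1 p)) (fun k => k.elim) (fun k => k.elim)
    (fun p hp => absurd hp (h2 p)) (fun k => k.elim)

/-- The class of a finite sequence of compact open subsets of the unit space. -/
def TypeSemigroup.mk (L : List (CompactOpenUnits G)) : TypeSemigroup G :=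
  Quotient.mk (typeSetoid G) L

theorem TypeSemigroup.exists_mk (x : TypeSemigroup G) : ∃ L, x = mk L := by
  obtain ⟨L, h⟩ := Quotient.exists_rep (s := typeSetoid G) x
  exact ⟨L, h.symm⟩

theorem TypeSemigroup.mk_nil : mk ([] : List (CompactOpenUnits G)) = 0 := rfl

theorem TypeSemigroup.mk_append (L M : List (CompactOpenUnits G)) : mk (L ++ M) = mk L + mk M := rfl

theorem TypeSemigroup.mk_cons (A : CompactOpenUnits G) (L : List (CompactOpenUnits G)) :
    mk (A :: L) = typeClass A + mk L := rfl

open TypeSemigroup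

theorem TypeSemigroup.mk_replicate (A : CompactOpenUnits G) (n : ℕ) :
    mk (List.replicate n A) = n • typeClass A := by
  induction n with
  | zero => exact (zero_nsmul _).symm
  | succ n ih => rw [List.replicate_succ, mk_cons, ih, succ_nsmul']

/-- The class of the unit space is an order unit. -/
theorem exists_nsmul_unitSpace_eq_add [CompactSpace (units G)] (x : TypeSemigroup G) :
    ∃ n : ℕ, ∃ z, n • typeClass (unitSpace G) = x + z := by
  obtain ⟨L, rfl⟩ := exists_mk x
  induction L with
  | nil => exact ⟨0, 0, by rw [zero_nsmul, add_zero, mk_nil]⟩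
  | cons A L ih =>
    obtain ⟨n, z, e⟩ := ih
    refine ⟨n + 1, typeClass ((unitSpace G).diff A) + z, ?_⟩
    rw [succ_nsmul', e, mk_cons, typeClass_add_diff (B := unitSpace G) A.2.2]
    exact add_add_add_comm _ _ _ _

/-- A relation `(n + 1) [A] ≤ n [A]` makes `A` paradoxical. -/
theorem isParadoxical_of_nsmul_eq {A : CompactOpenUnits G} (hA : A.1.Nonempty) {n : ℕ}
    (hn : 0 < n) {z : TypeSemigroup G}
    (h : n • typeClass A = (n + 1) • typeClass A + z) :
    IsParadoxical (compactOpenBisections G) (n + 1) n A.1 := by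
  obtain ⟨L, rfl⟩ := exists_mk z
  rw [← mk_replicate, ← mk_replicate, ← mk_append] at h
  -- In this direction the domains of the bisections fill the `n + 1` copies of `A` and the rest
  -- `L`, while their ranges stay in `n` copies of `A`.
  have h' : TypeEquiv (List.replicate (n + 1) A ++ L) (List.replicate n A) :=
    TypeEquiv.symm (Quotient.exact (s := typeSetoid G) h)
  obtain ⟨l, W, a, b, hW, a1, a2, a3, b1, b2, b3⟩ := h'.pointwise
  have hb : ∀ k w, w ∈ W k → b k < n := fun k w hw => (mem_levelSet_replicate.1 (b1 k w hw)).1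
  classical
  -- The `i`-th family keeps the bisections whose domain lies in the `i`-th copy; the others are
  -- replaced by `∅`, so that all families have the same index set.
  let V : Fin (n + 1) → Fin l → Set G := fun i k => if a k = i then W k else ∅
  have hV : ∀ i k w, w ∈ V i k ↔ a k = i ∧ w ∈ W k := by
    intro i k w
    by_cases hk : a k = i <;> simp [V, hk]
  refine ⟨hn, n.lt_succ_self, hA, fun _ => l, V,
    -- The default level occurs only when `W k` is empty, by `hb`.
    fun i k => if hk : b k < n then ⟨b k, hk⟩ else ⟨0, hn⟩, ?_, ?_, ?_, ?_⟩
  · intro i k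
    by_cases hk : a k = i
    · simpa [V, hk] using hW k
    · simpa [V, hk] using empty_mem_compactOpenBisections
  · intro i
    ext x
    simp only [mem_iUnion, mem_image, hV]
    constructor
    · rintro ⟨k, w, ⟨hk, hw⟩, rfl⟩
      have := a1 k w hw
      rw [hk, mem_levelSet_append, mem_levelSet_replicate] at this
      rcases this with h | ⟨j, hj, -⟩
      · exact h.2
      · have := i.2
        rw [List.length_replicate] at hj
        dsimp only at hj
        omega
    · intro hx
      obtain ⟨k, w, hw, e1, e2⟩ := a2 (x, i)
        (mem_levelSet_append.2 (Or.inl (mem_levelSet_replicate.2 ⟨i.2, hx⟩)))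
      exact ⟨k, w, ⟨e2, hw⟩, e1⟩
  · rintro i k _ ⟨w, hw, rfl⟩
    exact (mem_levelSet_replicate.1 (b1 k w ((hV _ _ _).1 hw).2)).2
  · rintro ⟨i, k⟩ ⟨i', k'⟩ hne
    rw [Set.disjoint_left]
    rintro ⟨x, j⟩ ⟨⟨w, hw, e1⟩, hj⟩ ⟨⟨w', hw', e2⟩, hj'⟩
    obtain ⟨hk, hw⟩ := (hV _ _ _).1 hw
    obtain ⟨hk', hw'⟩ := (hV _ _ _).1 hw'
    dsimp only at e1 e2 hj hj' hk hk'
    rw [mem_singleton_iff, dif_pos (hb k w hw)] at hj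
    rw [mem_singleton_iff, dif_pos (hb k' w' hw')] at hj'
    have hbb : b k = b k' := by rw [hj] at hj'; simpa using hj'
    obtain rfl := b3 k k' w hw w' hw' (e1.trans e2.symm) hbb
    obtain rfl : i = i' := Fin.ext (hk.symm.trans hk')
    exact hne rfl

/-- In a minimal groupoid, the class of every non-empty compact open subset of the unit space is
an order unit. -/
theorem exists_nsmul_typeClass_eq_add [CompactSpace (units G)] (hmin : IsMinimalGroupoid G)
    {A : CompactOpenUnits G} (hA : A.1.Nonempty) :
    ∃ n : ℕ, ∃ z, n • typeClass A = typeClass (unitSpace G) + z := by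
  -- The saturation `r(d⁻¹(A))` is open, its complement in the unit space is closed and invariant,
  -- and minimality leaves only the empty complement because `A` is non-empty.
  have hcov : ∀ x ∈ units G, ∃ h : G, rng h = x ∧ dom h ∈ A.1 := by
    have hO : IsOpen (rng '' (dom ⁻¹' A.1)) :=
      isOpenMap_rng _ (A.isOpen.preimage continuous_dom)
    have hinv : IsInvariant (units G \ rng '' (dom ⁻¹' A.1)) := by
      rintro g ⟨-, hg⟩
      refine ⟨rng_mem_units g, ?_⟩
      rintro ⟨h, hh, e⟩
      have c : Composable g⁻¹ h := composable_inv_mul_of_rng e.symm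
      exact hg ⟨g⁻¹ * h, by
        change dom (g⁻¹ * h) ∈ A.1
        rw [dom_mul c]
        exact hh, by rw [rng_mul c, rng_inv]⟩
    rcases hmin _ sdiff_subset ((isClosed_units.sdiff hO).preimage continuous_subtype_val) hinv
      with h | h
    · intro x hx
      by_contra hx'
      have : x ∈ units G \ rng '' (dom ⁻¹' A.1) := ⟨hx, fun ⟨g, hg, e⟩ => hx' ⟨g, e, hg⟩⟩
      rw [h] at this
      exact this
    · obtain ⟨x, hx⟩ := hA
      have : x ∈ units G \ rng '' (dom ⁻¹' A.1) := by
        rw [h]; exact A.2.2 hx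
      exact (this.2 ⟨x, by rwa [mem_preimage, dom_of_unit (A.2.2 hx)],
        rng_of_unit (A.2.2 hx)⟩).elim
  -- Each bisection of the cover costs one copy of `[A]`: the part of `B` in `r(V)` is carried by
  -- `V` to a subset of `A`, and the rest of `B` is covered by the remaining bisections.
  have key : ∀ (F : Finset (Set G)), (∀ V ∈ F, V ∈ compactOpenBisections G ∧ V ⊆ dom ⁻¹' A.1) →
      ∀ B : CompactOpenUnits G, (∀ x ∈ B.1, ∃ V ∈ F, x ∈ rng '' V) →
      ∃ n : ℕ, ∃ z, n • typeClass A = typeClass B + z := by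
    classical
    intro F
    induction F using Finset.induction_on with
    | empty =>
      intro _ B hB
      refine ⟨0, 0, ?_⟩
      rw [zero_nsmul, add_zero, typeClass_eq_zero]
      rw [Set.eq_empty_iff_forall_notMem]
      intro x hx
      simpa using hB x hx
    | insert V F hVF ih =>
      intro hF B hB
      obtain ⟨hV, hVA⟩ := hF V (by simp)
      obtain ⟨n, z, e⟩ := ih (fun W hW => hF W (by simp [hW])) (B.diff (rngOf V hV)) (by
        rintro x ⟨hx, hxV⟩
        obtain ⟨W, hW, hxW⟩ := hB x hx
        rcases Finset.mem_insert.1 hW with rfl | hW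
        · exact absurd hxW hxV
        · exact ⟨W, hW, hxW⟩)
      have hW : V ∩ rng ⁻¹' B.1 ∈ compactOpenBisections G :=
        inter_mem_compactOpenBisections hV
          (IsClopen.preimage ⟨B.isClosed, B.isOpen⟩ continuous_rng)
      have h1 : typeClass B = typeClass (rngOf _ hW) + typeClass (B.diff (rngOf V hV)) := by
        refine typeClass_union ?_ ?_
        · rw [Set.disjoint_left]
          rintro _ ⟨v, hv, rfl⟩ ⟨-, hn⟩
          exact hn ⟨v, hv.1, rfl⟩
        · ext x
          constructor
          · intro hx
            by_cases hxV : x ∈ rng '' V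
            · obtain ⟨v, hv, rfl⟩ := hxV
              exact Or.inl ⟨v, ⟨hv, hx⟩, rfl⟩
            · exact Or.inr ⟨hx, hxV⟩
          · rintro (⟨v, hv, rfl⟩ | h)
            exacts [hv.2, h.1]
      have h2 : typeClass A = typeClass (domOf _ hW) + typeClass (A.diff (domOf _ hW)) :=
        typeClass_add_diff (by rintro _ ⟨v, hv, rfl⟩; exact hVA hv.1)
      refine ⟨n + 1, z + typeClass (A.diff (domOf _ hW)), ?_⟩
      rw [succ_nsmul, e, h1, typeClass_rngOf]
      nth_rewrite 1 [h2]
      abel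
  obtain ⟨T, hT, hTf, hTc⟩ := (isCompact_iff_compactSpace.2 ‹CompactSpace (units G)›).elim_finite_subcover_image
    (b := {V | V ∈ compactOpenBisections G ∧ V ⊆ dom ⁻¹' A.1}) (c := fun V => rng '' V)
    (fun V hV => isOpenMap_rng V hV.1.2.1) (by
      intro x hx
      obtain ⟨h, rfl, hA⟩ := hcov x hx
      obtain ⟨V, hV, hhV, hVA⟩ := IsAmpleGroupoid.isTopologicalBasis.exists_subset_of_mem_open
        (show h ∈ dom ⁻¹' A.1 from hA) (A.isOpen.preimage continuous_dom)
      exact mem_biUnion (show V ∈ {V | V ∈ compactOpenBisections G ∧ V ⊆ dom ⁻¹' A.1} from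
        ⟨hV, hVA⟩) ⟨h, hhV, rfl⟩)
  refine key hTf.toFinset (fun V hV => hT (by simpa using hV)) (unitSpace G) fun x hx => ?_
  obtain ⟨V, hV, hxV⟩ := mem_iUnion₂.1 (hTc hx)
  exact ⟨V, by simpa using hV, hxV⟩

/-- If the unit space is not paradoxical, the type semigroup of a minimal groupoid has a faithful
state. -/
theorem exists_isFaithfulState [Nonempty G] [CompactSpace (units G)] (hmin : IsMinimalGroupoid G)
    (h : IsCompletelyNonParadoxical (compactOpenBisections G) (units G)) :
    ∃ φ : TypeSemigroup G → NNReal, IsFaithfulState φ ∧ φ (typeClass (unitSpace G)) = 1 := by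
  have hne : (unitSpace G).1.Nonempty := ⟨rng _, rng_mem_units (Classical.arbitrary G)⟩
  obtain ⟨φ, hφ⟩ := exists_state_of_orderUnit (u := typeClass (unitSpace G))
    (S := TypeSemigroup G) exists_nsmul_unitSpace_eq_add fun n hn z e =>
      h (n + 1) n hn n.lt_succ_self (isParadoxical_of_nsmul_eq hne hn e)
  refine ⟨φ, ⟨map_zero φ, map_add φ, ?_, ?_⟩, hφ⟩
  · rintro x _ ⟨z, rfl⟩
    rw [map_add]
    exact le_self_add
  · intro x hx
    obtain ⟨L, rfl⟩ := exists_mk x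
    induction L with
    | nil => rfl
    | cons A L ih =>
      rw [mk_cons, map_add, add_eq_zero] at hx
      -- If `A` were non-empty, some `n [A]` would dominate `[G⁽⁰⁾]`, so that `0 = n φ([A]) ≥ 1`.
      have hA : A.1 = ∅ := by
        by_contra hA
        obtain ⟨n, z, e⟩ := exists_nsmul_typeClass_eq_add hmin (nonempty_iff_ne_empty.2 hA)
        have := congrArg φ e
        rw [map_nsmul, map_add, hx.1, smul_zero, hφ] at this
        exact absurd this.symm (by simp)
      rw [mk_cons, typeClass_eq_zero hA, ih hx.2, add_zero]

end TypeClass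

end AlgGroupoid

/-! ### Characteristic functions of compact open bisections -/

/-- If `1` is a finite projection of `M_k(A)`, then no diagonal projection `p ⊗ 1` is equivalent to
a subprojection that misses a coordinate, unless `p = 0`. -/
theorem eq_zero_of_isFiniteProjection {A : Type*} [Ring A] [StarRing A] {k : ℕ}
    (h : IsFiniteProjection (1 : Matrix (Fin k) (Fin k) A)) {p : A} (hp : IsStarProjection p)
    {s : Matrix (Fin k) (Fin k) A} (hss : star s * s = Matrix.diagonal fun _ => p)
    (hps : ∀ c i, p * s c i = s c i) (l : Fin k) (hrow : ∀ i, s l i = 0) : p = 0 := by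
  obtain ⟨hpp, hp⟩ := hp
  rw [IsIdempotentElem] at hpp
  rw [IsSelfAdjoint] at hp
  -- Since `p s = s`, the ranges of `s` and `d` are orthogonal and `s + d` is an isometry, hence
  -- unitary by finiteness. Its row `l` is that of `d`, so the `(l, l)` entry of `(s + d)(s + d)*`
  -- is both `1` and `1 - p`.
  obtain ⟨d, hd'⟩ : ∃ d : Matrix (Fin k) (Fin k) A, d = Matrix.diagonal fun _ => 1 - p := ⟨_, rfl⟩
  have hd : star d = d := by
    rw [hd', Matrix.star_eq_conjTranspose, Matrix.diagonal_conjTranspose]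
    congr 1
    funext
    simp [hp]
  have hdd : d * d = d := by
    rw [hd', Matrix.diagonal_mul_diagonal]
    congr 1
    funext
    rw [mul_sub, mul_one, sub_mul, one_mul, hpp, sub_self, sub_zero]
  have hds : d * s = 0 := by
    ext1 c i
    rw [hd', Matrix.diagonal_mul, sub_mul, hps, one_mul, sub_self, Matrix.zero_apply]
  have hsd : star s * d = 0 := by
    rw [← star_star (star s * d), star_mul, star_star, hd, hds, star_zero]
  have hw : star (s + d) * (s + d) = 1 := by
    rw [star_add, add_mul, mul_add, mul_add, hd, hdd, hds, hsd, hss, add_zero, zero_add, hd',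
      Matrix.diagonal_add, ← Matrix.diagonal_one]
    simp
  have hq := h.2 ((s + d) * star (s + d)) (s + d) ⟨by
    rw [IsIdempotentElem, mul_assoc, ← mul_assoc (star (s + d)), hw, one_mul], by
    rw [IsSelfAdjoint, star_mul, star_star]⟩ (mul_one _) hw rfl
  have hq' : ((s + d) * star (s + d)) l l = (d * star d) l l := by
    simp only [Matrix.mul_apply, Matrix.star_apply, Matrix.add_apply, hrow, zero_add]
  rw [hq, hd, hdd, hd', Matrix.one_apply_eq, Matrix.diagonal_apply_eq, eq_comm, sub_eq_self] at hq'
  exact hq'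

namespace AlgGroupoid

section Indicator

variable {G : Type*} [AlgGroupoid G] [TopologicalSpace G] [T2Space G]

/-- The characteristic function of a compact open bisection. -/
noncomputable def indicatorMap (V : Set G) (hV : V ∈ compactOpenBisections G) :
    CompactlySupportedContinuousMap G ℂ where
  toFun := V.indicator 1
  continuous_toFun := continuous_one.indicator (by
    simp [(show IsClopen V from ⟨hV.1.isClosed, hV.2.1⟩).frontier_eq])
  hasCompactSupport' := HasCompactSupport.intro (K := V) hV.1 fun x hx => by simp [hx]

theorem indicatorMap_apply {V : Set G} (hV : V ∈ compactOpenBisections G) (x : G) :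
    indicatorMap V hV x = V.indicator 1 x := rfl

theorem indicatorMap_of_mem {V : Set G} (hV : V ∈ compactOpenBisections G) {x : G} (hx : x ∈ V) :
    indicatorMap V hV x = 1 := by simp [indicatorMap_apply, hx]

theorem indicatorMap_of_notMem {V : Set G} (hV : V ∈ compactOpenBisections G) {x : G}
    (hx : x ∉ V) : indicatorMap V hV x = 0 := by simp [indicatorMap_apply, hx]

variable [IsAmpleGroupoid G]

/-- As `r` is injective on `V`, the convolution sum at `g` has at most one non-zero term, and it is
`1` exactly when `g` factors through `V` and `W`. -/
theorem ccMul_indicatorMap {V W : Set G} (hV : V ∈ compactOpenBisections G)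
    (hW : W ∈ compactOpenBisections G) :
    ccMul (indicatorMap V hV) (indicatorMap W hW) =
      indicatorMap _ (mul_mem_compactOpenBisections hV hW) := by
  ext g
  change conv (indicatorMap V hV) (indicatorMap W hW) g = _
  obtain ⟨hVc, hVo, hVr, hVd⟩ := mem_compactOpenBisections.1 hV
  have h0 : ∀ x ∉ V, indicatorMap V hV x = 0 := fun x hx => indicatorMap_of_notMem hV hx
  by_cases h : ∃ h ∈ V, rng h = rng g
  · obtain ⟨v, hv, e⟩ := h
    have c := composable_inv_mul_of_rng e
    rw [conv_of_mem hVr h0 _ hv e, indicatorMap_of_mem hV hv, one_mul]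
    by_cases hw : v⁻¹ * g ∈ W
    · rw [indicatorMap_of_mem hW hw, indicatorMap_of_mem]
      exact ⟨v, hv, _, hw, by rw [rng_mul c, rng_inv], (mul_inv_mul_cancel e).symm⟩
    · rw [indicatorMap_of_notMem hW hw, indicatorMap_of_notMem]
      rintro ⟨v', hv', w, hw', e', rfl⟩
      have c' := composable_iff.2 e'
      rw [rng_mul c'] at e
      obtain rfl := hVr hv hv' e
      rw [inv_mul_cancel' c'] at hw
      exact hw hw'
  · rw [conv_of_notMem h0 _ fun v hv e => h ⟨v, hv, e⟩, indicatorMap_of_notMem]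
    rintro ⟨v, hv, w, hw, e, rfl⟩
    exact h ⟨v, hv, (rng_mul (composable_iff.2 e)).symm⟩

theorem ccStar_indicatorMap {V : Set G} (hV : V ∈ compactOpenBisections G) :
    ccStar (indicatorMap V hV) = indicatorMap _ (inv_mem_compactOpenBisections hV) := by
  ext g
  change star (indicatorMap V hV g⁻¹) = _
  by_cases h : g⁻¹ ∈ V
  · rw [indicatorMap_of_mem hV h, indicatorMap_of_mem _ (by exact h), star_one]
  · rw [indicatorMap_of_notMem hV h, indicatorMap_of_notMem _ (by exact h), star_zero]

/-! ### Bisections as partial isometries in the reduced C*-algebra -/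

variable [CompactSpace (units G)]

variable (G) in
/-- The embedding of `C_c(G)` into the reduced C*-algebra. -/
noncomputable def rep : CompactlySupportedContinuousMap G ℂ →ₗ[ℂ] reducedCStarAlgebra G where
  toFun f := ⟨regularRep f, subset_closure ⟨f, rfl⟩⟩
  map_add' f g := Subtype.ext (regularRep_add f g)
  map_smul' c f := Subtype.ext (regularRep_smul c f)

theorem rep_ccMul (f g : CompactlySupportedContinuousMap G ℂ) :
    rep G (ccMul f g) = rep G f * rep G g := Subtype.ext (regularRep_ccMul f g)

theorem rep_ccStar (f : CompactlySupportedContinuousMap G ℂ) :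
    rep G (ccStar f) = star (rep G f) := Subtype.ext (regularRep_ccStar f)

/-- The element of the reduced C*-algebra given by a compact open bisection. -/
noncomputable def chi (V : Set G) (hV : V ∈ compactOpenBisections G) : reducedCStarAlgebra G :=
  rep G (indicatorMap V hV)

theorem chi_congr {V W : Set G} (hV : V ∈ compactOpenBisections G)
    (hW : W ∈ compactOpenBisections G) (h : V = W) : chi V hV = chi W hW := by
  subst h; rfl

theorem chi_mul {V W : Set G} (hV : V ∈ compactOpenBisections G)
    (hW : W ∈ compactOpenBisections G) :
    chi V hV * chi W hW = chi _ (mul_mem_compactOpenBisections hV hW) := by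
  rw [chi, chi, ← rep_ccMul, ccMul_indicatorMap, chi]

theorem star_chi {V : Set G} (hV : V ∈ compactOpenBisections G) :
    star (chi V hV) = chi _ (inv_mem_compactOpenBisections hV) := by
  rw [chi, ← rep_ccStar, ccStar_indicatorMap, chi]

variable (G) in
theorem chi_units : chi (units G) (units_mem_compactOpenBisections G) = 1 :=
  Subtype.ext (regularRep_ccOne (G := G))

theorem chi_eq_zero {V : Set G} (hV : V ∈ compactOpenBisections G) (h : V = ∅) :
    chi V hV = 0 := by
  subst h
  have : indicatorMap ∅ hV = 0 := by ext x; exact indicatorMap_of_notMem hV (notMem_empty x)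
  rw [chi, this, map_zero]

theorem sum_chi {ι : Type*} [Fintype ι] {V : ι → Set G} (hV : ∀ i, V i ∈ compactOpenBisections G)
    {W : Set G} (hW : W ∈ compactOpenBisections G) (hd : ∀ i j x, x ∈ V i → x ∈ V j → i = j)
    (h : ⋃ i, V i = W) : ∑ i, chi (V i) (hV i) = chi W hW := by
  classical
  simp only [chi]
  rw [← map_sum]
  congr 1
  ext x
  rw [CompactlySupportedContinuousMap.sum_apply]
  by_cases hx : x ∈ W
  · rw [indicatorMap_of_mem hW hx]
    rw [← h] at hx
    obtain ⟨i, hi⟩ := mem_iUnion.1 hx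
    rw [Finset.sum_eq_single i, indicatorMap_of_mem _ hi]
    · exact fun j _ hj => indicatorMap_of_notMem _ fun hjx => hj (hd j i x hjx hi)
    · exact fun hi' => absurd (Finset.mem_univ i) hi'
  · rw [indicatorMap_of_notMem hW hx]
    refine Finset.sum_eq_zero fun i _ => indicatorMap_of_notMem _ fun hi => hx ?_
    rw [← h]
    exact mem_iUnion.2 ⟨i, hi⟩

/-- A product `v⁻¹ w` with `v ∈ V`, `w ∈ W` is composable only if `r(v) = r(w)`, so the product set
`V⁻¹ W` is empty. -/
theorem star_chi_mul_eq_zero {V W : Set G} (hV : V ∈ compactOpenBisections G)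
    (hW : W ∈ compactOpenBisections G) (h : Disjoint (rng '' V) (rng '' W)) :
    star (chi V hV) * chi W hW = 0 := by
  rw [star_chi, chi_mul]
  refine chi_eq_zero _ (eq_empty_iff_forall_notMem.2 ?_)
  rintro _ ⟨v, hv, w, hw, e, -⟩
  exact Set.disjoint_left.1 h ⟨_, hv, rfl⟩ ⟨w, hw, by rw [← e, rng_inv]⟩

/-- Injectivity of `r` on `V` leaves only the products `v⁻¹ v` in `V⁻¹ V`. -/
theorem star_chi_mul_self {V : Set G} (hV : V ∈ compactOpenBisections G) :
    star (chi V hV) * chi V hV = chi (dom '' V) (CompactOpenUnits.domOf V hV).2.1 := by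
  obtain ⟨hVc, hVo, hVr, hVd⟩ := mem_compactOpenBisections.1 hV
  rw [star_chi, chi_mul]
  refine chi_congr _ _ ?_
  ext x
  constructor
  · rintro ⟨v, hv, w, hw, e, rfl⟩
    obtain rfl : v⁻¹ = w := hVr hv hw (by simpa using e)
    exact ⟨v⁻¹, hv, by rw [dom, inv_inv']⟩
  · rintro ⟨v, hv, rfl⟩
    exact ⟨v⁻¹, by simpa [inv_inv'] using hv, v, hv, by simp, rfl⟩

theorem chi_mul_of_rng_subset {A V : Set G} (hA : A ∈ compactOpenBisections G) (hAu : A ⊆ units G)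
    (hV : V ∈ compactOpenBisections G) (h : rng '' V ⊆ A) : chi A hA * chi V hV = chi V hV := by
  rw [chi_mul]
  refine chi_congr _ _ ?_
  ext x
  constructor
  · rintro ⟨a, ha, w, hw, e, rfl⟩
    rw [dom_of_unit (hAu ha)] at e
    rwa [e, rng_mul_self]
  · intro hx
    exact ⟨rng x, h ⟨x, hx, rfl⟩, x, hx, by simp, (rng_mul_self x).symm⟩

theorem star_chi_of_subset_units {A : Set G} (hA : A ∈ compactOpenBisections G)
    (hAu : A ⊆ units G) : star (chi A hA) = chi A hA := by
  rw [star_chi]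
  refine chi_congr _ _ ?_
  ext x
  constructor
  · intro hx
    have := inv_of_unit (hAu hx)
    rw [inv_inv'] at this
    rw [this]
    exact hx
  · intro hx
    rw [mem_ofPred_eq, inv_of_unit (hAu hx)]
    exact hx

open Classical in
theorem chi_single {V : Set G} (hV : V ∈ compactOpenBisections G) (x y : G) :
    (chi V hV).1 (lp.single 2 y (1 : ℂ)) x = if dom x = dom y ∧ x * y⁻¹ ∈ V then 1 else 0 := by
  refine (regularRep_single _ x y).trans ?_
  by_cases h1 : dom x = dom y
  · by_cases h2 : x * y⁻¹ ∈ V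
    · rw [if_pos h1, if_pos ⟨h1, h2⟩, indicatorMap_of_mem hV h2]
    · rw [if_pos h1, if_neg (fun h => h2 h.2), indicatorMap_of_notMem hV h2]
  · rw [if_neg h1, if_neg (fun h => h1 h.1)]

/-- If the reduced C*-algebra is stably finite, then no subset of the unit space is paradoxical. -/
theorem not_isParadoxical_of_isStablyFinite (h : IsStablyFinite (reducedCStarAlgebra G))
    {A : Set G} {k l : ℕ} : ¬ IsParadoxical (compactOpenBisections G) k l A := by
  classical
  rintro ⟨hl, hlk, ⟨a, ha⟩, n, V, m, hV, hdom, hrng, hdisj⟩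
  have hAc : IsCompact A := by
    rw [← hdom ⟨0, by omega⟩]
    exact isCompact_iUnion fun j => (hV _ j).1.image continuous_dom
  have hAo : IsOpen A := by
    rw [← hdom ⟨0, by omega⟩]
    exact isOpen_iUnion fun j => isOpenMap_dom _ (hV _ j).2.1
  have hAu : A ⊆ units G := by
    rw [← hdom ⟨0, by omega⟩]
    rintro x hx
    obtain ⟨j, v, -, rfl⟩ := mem_iUnion.1 hx
    exact dom_mem_units v
  have hA := mem_compactOpenBisections_of_subset_units hAc hAo hAu
  -- make the domains disjoint
  let W : ∀ i, Fin (n i) → Set G := fun i j => V i j ∩ ⋂ j' : Fin (n i), ⋂ _ : j' < j,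
    dom ⁻¹' (dom '' V i j')ᶜ
  have hWV : ∀ i j, W i j ⊆ V i j := fun i j => inter_subset_left
  have hW : ∀ i j, W i j ∈ compactOpenBisections G := fun i j =>
    inter_mem_compactOpenBisections (hV i j) (isClopen_iInter_of_finite fun j' =>
      isClopen_iInter_of_finite fun _ => (IsClopen.compl
        ⟨((hV i j').1.image continuous_dom).isClosed, isOpenMap_dom _ (hV i j').2.1⟩).preimage
        continuous_dom)
  have hWdom : ∀ i, ⋃ j, dom '' W i j = A := by
    intro i
    rw [← hdom i]
    refine subset_antisymm (iUnion_mono fun j => image_mono (hWV i j)) ?_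
    intro x hx
    -- The point `x` survives in the piece with the least index `j` whose domain contains it.
    have hex : ∃ j : ℕ, ∃ hj : j < n i, x ∈ dom '' V i ⟨j, hj⟩ := by
      obtain ⟨j, hj⟩ := mem_iUnion.1 hx
      exact ⟨j, j.2, hj⟩
    obtain ⟨hj, v, hv, rfl⟩ := Nat.find_spec hex
    refine mem_iUnion.2 ⟨⟨_, hj⟩, v, ⟨hv, ?_⟩, rfl⟩
    refine mem_iInter₂.2 fun j' hlt hmem => ?_
    exact Nat.find_min hex hlt ⟨j'.2, hmem⟩
  have hWdisj : ∀ i j j' x, x ∈ dom '' W i j → x ∈ dom '' W i j' → j = j' := by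
    have key : ∀ i j j', j' < j → ∀ x, x ∈ dom '' W i j → x ∉ dom '' W i j' := by
      rintro i j j' hlt _ ⟨w, hw, rfl⟩ hx
      exact mem_iInter₂.1 hw.2 j' hlt (image_mono (hWV i j') hx)
    intro i j j' x hx hx'
    rcases lt_trichotomy j j' with hlt | rfl | hlt
    · exact absurd hx (key i j' j hlt x hx')
    · rfl
    · exact absurd hx' (key i j j' hlt x hx)
  let χ : ∀ i, Fin (n i) → reducedCStarAlgebra G := fun i j => chi (W i j) (hW i j)
  have hχ : ∀ i j i' j', (m i j : ℕ) = m i' j' →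
      (⟨i, j⟩ : Σ i, Fin (n i)) ≠ ⟨i', j'⟩ → star (χ i j) * χ i' j' = 0 := by
    intro i j i' j' hm hne
    refine star_chi_mul_eq_zero _ _ (Set.disjoint_left.2 fun x hx hx' => ?_)
    exact Set.disjoint_left.1 (hdisj hne) (show (x, m i j) ∈ _ ×ˢ _ from
      ⟨image_mono (hWV i j) hx, rfl⟩) ⟨image_mono (hWV i' j') hx', Fin.ext hm⟩
  let p : reducedCStarAlgebra G := chi A hA
  have hp : star p = p := star_chi_of_subset_units hA hAu
  have hpp : p * p = p := chi_mul_of_rng_subset hA hAu hA (by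
    rintro _ ⟨x, hx, rfl⟩
    rwa [rng_of_unit (hAu hx)])
  have hpχ : ∀ i j, p * χ i j = χ i j := fun i j =>
    chi_mul_of_rng_subset hA hAu _ ((image_mono (hWV i j)).trans (hrng i j))
  -- Column `i` is the `i`-th copy of `A`, row `c` the target level. All levels are below `l`, so
  -- the rows from `l` to `k - 1` vanish.
  let s : Matrix (Fin k) (Fin k) (reducedCStarAlgebra G) := Matrix.of fun c i =>
    ∑ j, if (m i j : ℕ) = c then χ i j else 0
  have hs : ∀ c i, s c i = ∑ j, if (m i j : ℕ) = c then χ i j else 0 := fun c i => rfl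
  -- Cross terms vanish because ranges on the same level are disjoint. The remaining terms `1_{d(W i
  -- j)}` add up to `1_A` because the domains now partition `A`.
  have hss : star s * s = Matrix.diagonal fun _ => p := by
    ext1 i i'
    rw [Matrix.mul_apply]
    simp only [Matrix.star_apply, hs, star_sum, Finset.sum_mul_sum]
    by_cases hii : i = i'
    · subst hii
      rw [Matrix.diagonal_apply_eq]
      have h1 : ∀ c : Fin k, (∑ j, ∑ j', star (if (m i j : ℕ) = c then χ i j else 0) *
          (if (m i j' : ℕ) = c then χ i j' else 0)) =
          ∑ j, if (m i j : ℕ) = c then star (χ i j) * χ i j else 0 := by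
        intro c
        refine Finset.sum_congr rfl fun j _ => ?_
        rw [Finset.sum_eq_single j]
        · split_ifs <;> simp
        · intro j' _ hj'
          split_ifs with e e'
          · exact hχ i j i j' (e.trans e'.symm) fun e => hj' (by simpa using e.symm)
          all_goals simp
        · exact fun hj => absurd (Finset.mem_univ j) hj
      rw [Finset.sum_congr rfl fun c _ => h1 c, Finset.sum_comm]
      have h2 : ∀ j, (∑ c : Fin k, if (m i j : ℕ) = c then star (χ i j) * χ i j else 0) =
          star (χ i j) * χ i j := by
        intro j
        rw [Finset.sum_eq_single ⟨m i j, (m i j).2.trans hlk⟩]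
        · simp
        · intro c _ hc
          rw [if_neg]
          rintro e
          exact hc (Fin.ext e.symm)
        · exact fun hj => absurd (Finset.mem_univ _) hj
      rw [Finset.sum_congr rfl fun j _ => h2 j,
        Finset.sum_congr rfl fun j _ => star_chi_mul_self (hW i j)]
      exact sum_chi _ hA (hWdisj i) (hWdom i)
    · rw [Matrix.diagonal_apply_ne _ hii]
      refine Finset.sum_eq_zero fun c _ => Finset.sum_eq_zero fun j _ =>
        Finset.sum_eq_zero fun j' _ => ?_
      split_ifs with e e'
      · exact hχ i j i' j' (e.trans e'.symm) fun e => hii (congrArg Sigma.fst e)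
      all_goals simp
  have hp0 : p = 0 := eq_zero_of_isFiniteProjection (h k) ⟨hpp, hp⟩ hss
    (fun c i => by
      rw [hs, Finset.mul_sum]
      refine Finset.sum_congr rfl fun j _ => ?_
      split_ifs
      exacts [hpχ i j, mul_zero _]) ⟨l, hlk⟩
    (fun i => (hs _ i).trans (Finset.sum_eq_zero fun j _ => if_neg (m i j).2.ne))
  -- The diagonal coefficient of `1_A` at the point `a` of `A` is `1`, so `p` is not zero.
  have h1 := chi_single hA a a
  rw [if_pos ⟨rfl, by change rng a ∈ A; rwa [rng_of_unit (hAu ha)]⟩] at h1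
  have h2 : (chi A hA).1 = 0 := congrArg Subtype.val hp0
  rw [h2] at h1
  simp at h1

end Indicator

end AlgGroupoid

/-! ### Measures from additive functions on clopen sets -/

section ClopenMeasure

open TopologicalSpace

variable {X : Type*} [TopologicalSpace X] [CompactSpace X] [T2Space X]
  [TotallyDisconnectedSpace X] {φ : Clopens X → NNReal}

theorem exists_clopens_separating {K L : Set X} (hK : IsClosed K) (hL : IsClosed L)
    (h : Disjoint K L) : ∃ A : Clopens X, K ⊆ A ∧ Disjoint (A : Set X) L := by
  obtain ⟨C, hC, hKC, hCL⟩ := exists_clopen_of_closed_subset_open hK hL.isOpen_compl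
    h.subset_compl_right
  exact ⟨⟨C, hC⟩, hKC, Set.disjoint_left.2 hCL⟩

/-- The content that takes a compact set to the infimum of the values of its clopen
neighbourhoods. -/
noncomputable def clopenContent
    (hφ : ∀ A B : Clopens X, Disjoint (A : Set X) B → φ (A ⊔ B) = φ A + φ B) :
    MeasureTheory.Content X := by
  have mono : ∀ A B : Clopens X, (A : Set X) ⊆ B → φ A ≤ φ B := by
    intro A B h
    have : B = A ⊔ B \ A := (sup_sdiff_cancel_right (SetLike.coe_subset_coe.1 h)).symm
    rw [this, hφ _ _ (by rw [Clopens.coe_sdiff]; exact disjoint_sdiff_right)]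
    exact le_self_add
  have sub : ∀ A B : Clopens X, φ (A ⊔ B) ≤ φ A + φ B := by
    intro A B
    rw [← sup_sdiff_self_right, hφ _ _ (by rw [Clopens.coe_sdiff]; exact disjoint_sdiff_right)]
    exact add_le_add le_rfl (mono _ _ (by rw [Clopens.coe_sdiff]; exact sdiff_subset))
  have hne : ∀ K : Set X, Nonempty {A : Clopens X // K ⊆ A} := fun K =>
    ⟨⊤, by simp⟩
  have hb : ∀ K : Set X, BddBelow (range fun A : {A : Clopens X // K ⊆ A} => φ A.1) := fun K =>
    OrderBot.bddBelow _
  have hle : ∀ K L : Set X, (⨅ A : {A : Clopens X // K ∪ L ⊆ A}, φ A.1) ≤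
      (⨅ A : {A : Clopens X // K ⊆ A}, φ A.1) + ⨅ A : {A : Clopens X // L ⊆ A}, φ A.1 :=
    fun K L => NNReal.le_iInf_add_iInf fun A B =>
      (ciInf_le (hb _) ⟨A.1 ⊔ B.1, by
        rw [Clopens.coe_sup]; exact union_subset_union A.2 B.2⟩).trans (sub _ _)
  refine ⟨fun K => ⨅ A : {A : Clopens X // (K : Set X) ⊆ A}, φ A.1, ?_, ?_, ?_⟩
  · intro K L h
    exact le_ciInf fun A => ciInf_le (hb _) ⟨A.1, h.trans A.2⟩
  · intro K L hd hK hL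
    rw [Compacts.coe_sup]
    refine le_antisymm (hle _ _) (le_ciInf fun A => ?_)
    -- A clopen set `C` around `K` that misses `L` cuts every clopen neighbourhood of `K ∪ L` into a
    -- neighbourhood of `K` and one of `L`; this gives superadditivity.
    obtain ⟨C, hKC, hCL⟩ := exists_clopens_separating hK hL hd
    have h1 : A.1 ⊓ C ⊔ A.1 \ C = A.1 := sup_inf_sdiff _ _
    rw [← h1, hφ _ _ (by
      rw [Clopens.coe_sdiff, Clopens.coe_inf]
      exact disjoint_sdiff_right.mono_left inter_subset_right)]
    refine add_le_add (ciInf_le (hb _) ⟨A.1 ⊓ C, ?_⟩) (ciInf_le (hb _) ⟨A.1 \ C, ?_⟩)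
    · rw [Clopens.coe_inf]
      exact subset_inter (subset_union_left.trans A.2) hKC
    · rw [Clopens.coe_sdiff]
      exact fun x hx => ⟨A.2 (Or.inr hx), fun hxC => Set.disjoint_left.1 hCL hxC hx⟩
  · intro K L
    rw [Compacts.coe_sup]
    exact hle _ _

/-- An additive function on the clopen subsets of a profinite space extends to a Borel measure. -/
theorem exists_measure_clopens [MeasurableSpace X] [BorelSpace X]
    (hφ : ∀ A B : Clopens X, Disjoint (A : Set X) B → φ (A ⊔ B) = φ A + φ B) :
    ∃ μ : MeasureTheory.Measure X, ∀ A : Clopens X, μ A = φ A := by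
  refine ⟨(clopenContent hφ).measure, fun A => ?_⟩
  have hA : IsCompact (A : Set X) := A.isClopen.isClosed.isCompact
  rw [MeasureTheory.Content.measure_apply _ A.isClopen.isOpen.measurableSet,
    MeasureTheory.Content.outerMeasure_of_isOpen _ _ A.isClopen.isOpen,
    MeasureTheory.Content.innerContent_of_isCompact _ hA A.isClopen.isOpen]
  -- A clopen set is its own least clopen neighbourhood, so the infimum is attained at `A`.
  refine ENNReal.coe_inj.2 (le_antisymm ?_ ?_)
  · exact ciInf_le (OrderBot.bddBelow _) (⟨A, subset_rfl⟩ : {B : Clopens X // (A : Set X) ⊆ B})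
  · have : Nonempty {B : Clopens X // (A : Set X) ⊆ B} := ⟨⟨A, subset_rfl⟩⟩
    refine le_ciInf (f := fun B : {B : Clopens X // (A : Set X) ⊆ B} => φ B.1) fun B => ?_
    have : B.1 = A ⊔ B.1 \ A := (sup_sdiff_cancel_right (SetLike.coe_subset_coe.1 B.2)).symm
    rw [this, hφ _ _ (by rw [Clopens.coe_sdiff]; exact disjoint_sdiff_right)]
    exact le_self_add

end ClopenMeasure

/-! ### Density of the characteristic functions -/

namespace AlgGroupoid

variable {G : Type*} [AlgGroupoid G] [TopologicalSpace G] [IsAmpleGroupoid G] [T2Space G]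

/-- For `f` supported in a bisection, `f ∗ ξ` permutes the coordinates of `ξ` injectively and
multiplies them by values of `f`. Hence uniform approximation inside one bisection is approximation
in the reduced norm. -/
theorem norm_regularRep_le {S : Set G} (hS : S ∈ compactOpenBisections G)
    {f : CompactlySupportedContinuousMap G ℂ} (hf : ∀ x ∉ S, f x = 0) {C : ℝ} (hC0 : 0 ≤ C)
    (hC : ∀ x, ‖f x‖ ≤ C) : ‖regularRep f‖ ≤ C := by
  classical
  obtain ⟨hSc, hSo, hSr, hSd⟩ := mem_compactOpenBisections.1 hS
  refine ContinuousLinearMap.opNorm_le_bound _ hC0 fun ξ => ?_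
  refine lp.norm_le_of_forall_sum_le (by norm_num) (by positivity) fun F => ?_
  simp only [ENNReal.toReal_ofNat, Real.rpow_ofNat, regularRep_apply]
  let F' := F.filter fun g => ∃ h ∈ S, rng h = rng g
  have h0 : ∑ g ∈ F, ‖conv f ξ g‖ ^ 2 = ∑ g ∈ F', ‖conv f ξ g‖ ^ 2 := by
    rw [Finset.sum_filter_of_ne]
    intro g _ hg
    by_contra h
    exact hg (by rw [conv_of_notMem hf _ fun h' hh e => h ⟨h', hh, e⟩]; simp)
  rw [h0]
  have hex : ∀ g : G, ∃ k h : G, (∃ h ∈ S, rng h = rng g) →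
      h ∈ S ∧ rng h = rng g ∧ k = h⁻¹ * g := by
    intro g
    by_cases h : ∃ h ∈ S, rng h = rng g
    · obtain ⟨h, hh, e⟩ := h
      exact ⟨h⁻¹ * g, h, fun _ => ⟨hh, e, rfl⟩⟩
    · exact ⟨g, g, fun h' => absurd h' h⟩
  choose t s ht using hex
  have ht' : ∀ g ∈ F', s g ∈ S ∧ rng (s g) = rng g ∧ t g = (s g)⁻¹ * g := fun g hg =>
    ht g (Finset.mem_filter.1 hg).2
  have hinj : InjOn t F' := by
    intro x hx y hy hxy
    obtain ⟨hh, e, ek⟩ := ht' x hx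
    obtain ⟨hh', e', ek'⟩ := ht' y hy
    have hd : dom (s x) = dom (s y) := by
      rw [← rng_inv, ← rng_inv, ← rng_mul (composable_inv_mul_of_rng e),
        ← rng_mul (composable_inv_mul_of_rng e'), ← ek, ← ek', hxy]
    have hss := hSd hh hh' hd
    rw [← mul_inv_mul_cancel e, ← mul_inv_mul_cancel e', ← ek, ← ek', hxy, hss]
  have hξ : ∑ k ∈ F'.image t, ‖ξ k‖ ^ 2 ≤ ‖ξ‖ ^ 2 := by
    have := lp.sum_rpow_le_norm_rpow (p := 2) (by norm_num) ξ (F'.image t)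
    simpa using this
  rw [Finset.sum_image hinj] at hξ
  calc ∑ g ∈ F', ‖conv f ξ g‖ ^ 2 ≤ ∑ g ∈ F', C ^ 2 * ‖ξ (t g)‖ ^ 2 := by
        refine Finset.sum_le_sum fun g hg => ?_
        obtain ⟨hh, e, ek⟩ := ht' g hg
        rw [conv_of_mem hSr hf _ hh e, ← ek, norm_mul, mul_pow]
        gcongr
        exact hC _
    _ ≤ C ^ 2 * ‖ξ‖ ^ 2 := by
        rw [← Finset.mul_sum]
        gcongr
    _ = (C * ‖ξ‖) ^ 2 := by ring

variable [CompactSpace (units G)]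

/-- The span of the elements given by the compact open bisections is dense in the reduced
C*-algebra. -/
theorem reducedCStarAlgebra_induction {P : reducedCStarAlgebra G → Prop}
    (hchi : ∀ V (hV : V ∈ compactOpenBisections G), P (chi V hV))
    (hadd : ∀ a b, P a → P b → P (a + b)) (hsmul : ∀ (c : ℂ) a, P a → P (c • a))
    (hclosed : IsClosed {a | P a}) (a : reducedCStarAlgebra G) : P a := by
  classical
  -- The approximant is a step function: `S` is cut successively along the clopen members of `F`, on
  -- each of which `f` is constant up to `ε`.
  have happrox : ∀ (f : CompactlySupportedContinuousMap G ℂ) (ε : ℝ) (F : Finset (Set G)),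
      (∀ V ∈ F, V ∈ compactOpenBisections G ∧ ∃ c : ℂ, ∀ x ∈ V, ‖f x - c‖ ≤ ε) →
      ∀ S ∈ compactOpenBisections G, (∀ x ∈ S, ∃ V ∈ F, x ∈ V) →
      ∃ h : CompactlySupportedContinuousMap G ℂ, P (rep G h) ∧ (∀ x ∉ S, h x = 0) ∧
        ∀ x ∈ S, ‖f x - h x‖ ≤ ε := by
    intro f ε F
    induction F using Finset.induction_on with
    | empty =>
      intro _ S _ hS
      refine ⟨0, ?_, fun _ _ => rfl, fun x hx => ?_⟩
      · rw [map_zero, ← chi_eq_zero empty_mem_compactOpenBisections rfl]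
        exact hchi _ _
      · simpa using hS x hx
    | insert V F hVF ih =>
      intro hF S hS hcov
      obtain ⟨hV, c, hc⟩ := hF V (by simp)
      have hVcl : IsClopen V := ⟨hV.1.isClosed, hV.2.1⟩
      have hS1 : S ∩ V ∈ compactOpenBisections G := inter_mem_compactOpenBisections hS hVcl
      have hS2 : S ∩ Vᶜ ∈ compactOpenBisections G := inter_mem_compactOpenBisections hS hVcl.compl
      obtain ⟨h, hP, h0, hε⟩ := ih (fun W hW => hF W (by simp [hW])) (S ∩ Vᶜ) hS2 (by
        rintro x ⟨hx, hxV⟩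
        obtain ⟨W, hW, hxW⟩ := hcov x hx
        rcases Finset.mem_insert.1 hW with rfl | hW
        exacts [absurd hxW hxV, ⟨W, hW, hxW⟩])
      refine ⟨c • indicatorMap _ hS1 + h, ?_, fun x hx => ?_, fun x hx => ?_⟩
      · rw [map_add, map_smul]
        exact hadd _ _ (hsmul _ _ (hchi _ _)) hP
      · rw [CompactlySupportedContinuousMap.add_apply, CompactlySupportedContinuousMap.smul_apply,
          indicatorMap_of_notMem _ fun h => hx h.1, h0 x fun h => hx h.1, smul_zero, add_zero]
      · rw [CompactlySupportedContinuousMap.add_apply, CompactlySupportedContinuousMap.smul_apply]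
        by_cases hxV : x ∈ V
        · rw [indicatorMap_of_mem _ (show x ∈ S ∩ V from ⟨hx, hxV⟩), h0 x fun h => h.2 hxV, smul_eq_mul, mul_one,
            add_zero]
          exact hc x hxV
        · rw [indicatorMap_of_notMem _ fun h => hxV h.2, smul_zero, zero_add]
          exact hε x ⟨hx, hxV⟩
  have hrep : ∀ f : CompactlySupportedContinuousMap G ℂ, P (rep G f) := by
    intro f
    induction f using cc_induction with
    | hadd f g hf hg =>
      rw [map_add]
      exact hadd _ _ hf hg
    | hbis f S hS hf =>
      refine hclosed.closure_subset (Metric.mem_closure_iff.2 fun ε hε => ?_)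
      obtain ⟨T, hT, hTf, hTc⟩ := hS.1.elim_finite_subcover_image
        (b := {V | V ∈ compactOpenBisections G ∧ ∃ c : ℂ, ∀ x ∈ V, ‖f x - c‖ ≤ ε / 2})
        (c := id) (fun V hV => hV.1.2.1) (by
          intro x _
          have ho : IsOpen {y | ‖f y - f x‖ < ε / 2} :=
            isOpen_lt (((map_continuous f).sub continuous_const).norm) continuous_const
          obtain ⟨V, hV, hxV, hVs⟩ :=
            IsAmpleGroupoid.isTopologicalBasis.exists_subset_of_mem_open
              (show x ∈ {y | ‖f y - f x‖ < ε / 2} by simpa using hε) ho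
          exact mem_biUnion (show V ∈ {V | V ∈ compactOpenBisections G ∧
            ∃ c : ℂ, ∀ x ∈ V, ‖f x - c‖ ≤ ε / 2} from ⟨hV, f x, fun y hy => (hVs hy).le⟩) hxV)
      obtain ⟨h, hP, h0, hε'⟩ := happrox f (ε / 2) hTf.toFinset
        (fun V hV => hT (by simpa using hV)) S hS fun x hx => by
          obtain ⟨V, hV, hxV⟩ := mem_iUnion₂.1 (hTc hx)
          exact ⟨V, by simpa using hV, hxV⟩
      refine ⟨rep G h, hP, ?_⟩
      rw [dist_eq_norm, ← map_sub]
      refine lt_of_le_of_lt (norm_regularRep_le hS (fun x hx => ?_) (half_pos hε).le fun x => ?_)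
        (half_lt_self hε)
      · rw [CompactlySupportedContinuousMap.sub_apply, hf x hx, h0 x hx, sub_zero]
      · rw [CompactlySupportedContinuousMap.sub_apply]
        by_cases hx : x ∈ S
        · exact hε' x hx
        · rw [hf x hx, h0 x hx, sub_zero, norm_zero]
          exact (half_pos hε).le
  refine hclosed.closure_subset (Metric.mem_closure_iff.2 fun ε hε => ?_)
  obtain ⟨_, ⟨f, rfl⟩, hlt⟩ := Metric.mem_closure_iff.1 a.2 ε hε
  exact ⟨rep G f, hrep f, hlt⟩

end AlgGroupoid

/-! ### The trace of a state -/

section MulComm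

variable {A : Type*} [Ring A] [Algebra ℂ A] {τ : A →ₗ[ℂ] ℂ}

theorem map_mul_comm_add {a b b' : A} (h : τ (a * b) = τ (b * a)) (h' : τ (a * b') = τ (b' * a)) :
    τ (a * (b + b')) = τ ((b + b') * a) := by
  rw [mul_add, add_mul, map_add, map_add, h, h']

theorem map_mul_comm_smul {a b : A} (c : ℂ) (h : τ (a * b) = τ (b * a)) :
    τ (a * (c • b)) = τ ((c • b) * a) := by
  rw [mul_smul_comm, smul_mul_assoc, map_smul, map_smul, h]

theorem isClosed_map_mul_comm [TopologicalSpace A] [ContinuousMul A] (hτ : Continuous τ) (a : A) :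
    IsClosed {b | τ (a * b) = τ (b * a)} :=
  isClosed_eq (hτ.comp (continuous_const_mul a)) (hτ.comp (continuous_mul_const a))

end MulComm

namespace AlgGroupoid

variable {G : Type*} [AlgGroupoid G] [TopologicalSpace G] [IsAmpleGroupoid G] [T2Space G]

/-- Compact open bisections are clopen, and their traces on the unit space form a basis. -/
instance : TotallyDisconnectedSpace (units G) := by
  have : TotallySeparatedSpace (units G) := by
    refine totallySeparatedSpace_of_t0_of_basis_clopen
      (TopologicalSpace.isTopologicalBasis_of_isOpen_of_nhds (fun s hs => IsClopen.isOpen hs) ?_)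
    rintro x U hx hU
    obtain ⟨U', hU', rfl⟩ := isOpen_induced_iff.1 hU
    obtain ⟨V, hV, hxV, hVU⟩ :=
      IsAmpleGroupoid.isTopologicalBasis.exists_subset_of_mem_open (show (x : G) ∈ U' from hx) hU'
    have hcl : IsClopen (Subtype.val ⁻¹' V : Set (units G)) :=
      IsClopen.preimage ⟨hV.1.isClosed, hV.2.1⟩ continuous_subtype_val
    exact ⟨_, hcl, hxV, preimage_mono hVU⟩
  infer_instance

variable [CompactSpace (units G)]

/-! ### Matrix coefficients and the diagonal -/

open Classical in
variable (G) in
/-- The matrix coefficients of the elements of the reduced C*-algebra. -/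
noncomputable def coeff (x y : G) : reducedCStarAlgebra G →ₗ[ℂ] ℂ where
  toFun a := a.1 (lp.single 2 y (1 : ℂ)) x
  map_add' _ _ := rfl
  map_smul' _ _ := rfl

open Classical in
theorem coeff_apply (x y : G) (a : reducedCStarAlgebra G) :
    coeff G x y a = a.1 (lp.single 2 y (1 : ℂ)) x := rfl

theorem norm_coeff_le (x y : G) (a : reducedCStarAlgebra G) : ‖coeff G x y a‖ ≤ ‖a‖ := by
  classical
  refine (lp.norm_apply_le_norm (by norm_num) _ x).trans ((a.1.le_opNorm _).trans ?_)
  rw [lp.norm_single (by norm_num), norm_one, mul_one]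
  rfl

theorem continuous_coeff (x y : G) : Continuous (coeff G x y) :=
  (LinearMap.mkContinuous (coeff G x y) 1 fun a => by
    rw [one_mul]; exact norm_coeff_le x y a).continuous

open Classical in
theorem coeff_chi {V : Set G} (hV : V ∈ compactOpenBisections G) (x y : G) :
    coeff G x y (chi V hV) = if dom x = dom y ∧ x * y⁻¹ ∈ V then 1 else 0 := chi_single hV x y

/-- The elements of the reduced C*-algebra commute with right translations. -/
theorem coeff_eq_coeff_rng (x y : G) (a : reducedCStarAlgebra G) :
    coeff G x y a = coeff G (x * y⁻¹) (rng y) a ∨ dom x ≠ dom y := by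
  classical
  by_cases e : dom x = dom y
  · left
    have c := composable_mul_inv_of_dom e
    induction a using reducedCStarAlgebra_induction with
    | hchi V hV =>
      have h1 : x * y⁻¹ * (rng y)⁻¹ = x * y⁻¹ := by
        have := mul_dom_self (x * y⁻¹)
        rw [dom_mul c, dom_inv] at this
        rw [inv_of_unit (rng_mem_units y), this]
      rw [coeff_chi, coeff_chi, h1, dom_mul c, dom_inv, dom_rng]
      simp [e]
    | hadd a b ha hb => rw [map_add, map_add, ha, hb]
    | hsmul c a ha => rw [map_smul, map_smul, ha]
    | hclosed => exact isClosed_eq (continuous_coeff _ _) (continuous_coeff _ _)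
  · exact Or.inr e

theorem coeff_eq_zero_of_dom_ne {x y : G} (e : dom x ≠ dom y) (a : reducedCStarAlgebra G) :
    coeff G x y a = 0 := by
  classical
  induction a using reducedCStarAlgebra_induction with
  | hchi V hV => rw [coeff_chi, if_neg fun h => e h.1]
  | hadd a b ha hb => rw [map_add, ha, hb, add_zero]
  | hsmul c a ha => rw [map_smul, ha, smul_zero]
  | hclosed => exact isClosed_eq (continuous_coeff _ _) continuous_const

/-- Right translation by `y⁻¹` turns the column at `y` into the column at the unit `r(y)`, and
entries between different fibres of `d` vanish. -/
theorem eq_zero_of_coeff {a : reducedCStarAlgebra G}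
    (h : ∀ x, ∀ u ∈ units G, coeff G x u a = 0) : a = 0 := by
  refine Subtype.ext (clm_ext fun x y => ?_)
  change coeff G x y a = 0
  rcases coeff_eq_coeff_rng x y a with e | e
  · rw [e, h _ _ (rng_mem_units y)]
  · exact coeff_eq_zero_of_dom_ne e a

/-- The number is `⟨δ_u, a* a δ_u⟩ = ‖a δ_u‖²`, and `a δ_u` is the column of `a` at `u`. -/
theorem coeff_star_mul_self (u : G) (a : reducedCStarAlgebra G) :
    ∃ r : ℝ, coeff G u u (star a * a) = r ∧ 0 ≤ r ∧ (r = 0 → ∀ x, coeff G x u a = 0) := by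
  classical
  refine ⟨‖a.1 (lp.single 2 u (1 : ℂ))‖ ^ 2, ?_, by positivity, fun h x => ?_⟩
  · have h1 := lp.inner_single_left (𝕜 := ℂ) (G := fun _ : G => ℂ) u (1 : ℂ)
      ((star a * a).1 (lp.single 2 u (1 : ℂ)))
    have h2 : (star a * a).1 (lp.single 2 u (1 : ℂ)) =
      ContinuousLinearMap.adjoint a.1 (a.1 (lp.single 2 u (1 : ℂ))) := rfl
    simp only [RCLike.inner_apply, map_one, mul_one] at h1
    rw [coeff_apply, ← h1, h2, ContinuousLinearMap.adjoint_inner_right, inner_self_eq_norm_sq_to_K]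
    simp
  · have : a.1 (lp.single 2 u (1 : ℂ)) = 0 := by simpa using h
    rw [coeff_apply, this]
    rfl

/-- The diagonal of `1_V` is the characteristic function of the clopen set `V ∩ G⁽⁰⁾`. Since
coefficients are bounded by the norm, limits in norm give uniform limits of diagonals. -/
theorem continuous_diagonal (a : reducedCStarAlgebra G) :
    Continuous fun u : units G => coeff G (u : G) (u : G) a := by
  classical
  induction a using reducedCStarAlgebra_induction with
  | hchi V hV =>
    have : (fun u : units G => coeff G (u : G) (u : G) (chi V hV)) =
        fun u : units G => indicatorMap V hV u := by
      funext u
      rw [coeff_chi, show (u : G) * (u : G)⁻¹ = u from rng_of_unit u.2]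
      by_cases h : (u : G) ∈ V
      · rw [if_pos ⟨rfl, h⟩, indicatorMap_of_mem hV h]
      · rw [if_neg (fun h' => h h'.2), indicatorMap_of_notMem hV h]
    rw [this]
    exact (map_continuous _).comp continuous_subtype_val
  | hadd a b ha hb =>
    simp only [map_add]
    exact ha.add hb
  | hsmul c a ha =>
    simp only [map_smul]
    exact ha.const_smul c
  | hclosed =>
    refine isClosed_of_closure_subset fun a ha => ?_
    refine continuous_of_uniform_approx_of_continuous fun U hU => ?_
    obtain ⟨ε, hε, hεU⟩ := Metric.mem_uniformity_dist.1 hU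
    obtain ⟨b, hb, hab⟩ := Metric.mem_closure_iff.1 ha ε hε
    refine ⟨_, hb, fun u => hεU ?_⟩
    rw [dist_eq_norm, ← map_sub]
    rw [dist_eq_norm] at hab
    exact (norm_coeff_le _ _ _).trans_lt hab

section Trace

variable [MeasurableSpace (units G)] [BorelSpace (units G)]
  (μ : MeasureTheory.Measure (units G)) [MeasureTheory.IsFiniteMeasure μ]

theorem integrable_diagonal (a : reducedCStarAlgebra G) :
    MeasureTheory.Integrable (fun u : units G => coeff G (u : G) (u : G) a) μ :=
  (continuous_diagonal a).integrable_of_hasCompactSupport (HasCompactSupport.of_compactSpace _)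

/-- The functional on the reduced C*-algebra that integrates the diagonal. -/
noncomputable def integralDiagonal : reducedCStarAlgebra G →ₗ[ℂ] ℂ where
  toFun a := ∫ u : units G, coeff G (u : G) (u : G) a ∂μ
  map_add' a b := by
    simp only [map_add]
    exact MeasureTheory.integral_add (integrable_diagonal μ a) (integrable_diagonal μ b)
  map_smul' c a := by
    simp only [map_smul]
    exact MeasureTheory.integral_smul c _

theorem integralDiagonal_apply (a : reducedCStarAlgebra G) :
    integralDiagonal μ a = ∫ u : units G, coeff G (u : G) (u : G) a ∂μ := rfl

theorem continuous_integralDiagonal : Continuous (integralDiagonal (G := G) μ) :=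
  (LinearMap.mkContinuous (integralDiagonal μ) (μ.real univ) fun a => by
    rw [mul_comm]
    exact MeasureTheory.norm_integral_le_of_norm_le_const
      (Filter.Eventually.of_forall fun u => norm_coeff_le _ _ a)).continuous

theorem integralDiagonal_chi {V : Set G} (hV : V ∈ compactOpenBisections G) :
    integralDiagonal μ (chi V hV) = μ.real ((↑) ⁻¹' V : Set (units G)) := by
  classical
  have h : (fun u : units G => coeff G (u : G) (u : G) (chi V hV)) =
      ((↑) ⁻¹' V : Set (units G)).indicator 1 := by
    funext u
    rw [coeff_chi, show (u : G) * (u : G)⁻¹ = u from rng_of_unit u.2]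
    by_cases h : (u : G) ∈ V <;> simp [h]
  have hm : MeasurableSet ((↑) ⁻¹' V : Set (units G)) :=
    (hV.2.1.preimage continuous_subtype_val).measurableSet
  rw [integralDiagonal_apply, h, MeasureTheory.integral_indicator hm]
  simp

/-- If `v w` is a unit, then `w = v⁻¹`. Hence the units in `V W` form `r(V ∩ W⁻¹)` and those in `W
V` form `d(V ∩ W⁻¹)`, and invariance applies to the single bisection `V ∩ W⁻¹`. -/
theorem integralDiagonal_chi_mul_comm
    (hinv : ∀ V ∈ compactOpenBisections G, μ ((↑) ⁻¹' (rng '' V)) = μ ((↑) ⁻¹' (dom '' V)))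
    {V W : Set G} (hV : V ∈ compactOpenBisections G) (hW : W ∈ compactOpenBisections G) :
    integralDiagonal μ (chi V hV * chi W hW) = integralDiagonal μ (chi W hW * chi V hV) := by
  rw [chi_mul, chi_mul, integralDiagonal_chi, integralDiagonal_chi,
    MeasureTheory.measureReal_def, MeasureTheory.measureReal_def]
  have hB : V ∩ {x | x⁻¹ ∈ W} ∈ compactOpenBisections G :=
    inter_mem_compactOpenBisections hV
      ⟨(inv_mem_compactOpenBisections hW).1.isClosed, (inv_mem_compactOpenBisections hW).2.1⟩
  have e1 : ∀ (V W : Set G) (u : units G), (∃ v ∈ V, ∃ w ∈ W, dom v = rng w ∧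
      (u : G) = v * w) ↔ ∃ v, (v ∈ V ∧ v⁻¹ ∈ W) ∧ rng v = u := by
    intro V W u
    constructor
    · rintro ⟨v, hv, w, hw, e, h⟩
      have c := composable_iff.2 e
      have e2 : dom w = rng v := by
        rw [← dom_mul c, ← rng_mul c, ← h, dom_of_unit u.2, rng_of_unit u.2]
      have e3 : v⁻¹ = w := by
        rw [← inv_mul_cancel' c, ← h, ← dom_of_unit u.2, h, dom_mul c, e2, ← dom_inv,
          mul_dom_self]
      exact ⟨v, ⟨hv, e3 ▸ hw⟩, by rw [← rng_mul c, ← h, rng_of_unit u.2]⟩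
    · rintro ⟨v, ⟨hv, hw⟩, e⟩
      exact ⟨v, hv, v⁻¹, hw, (rng_inv v).symm, e.symm⟩
  have hV1 : ((↑) ⁻¹' {x : G | ∃ v ∈ V, ∃ w ∈ W, dom v = rng w ∧ x = v * w} :
      Set (units G)) = (↑) ⁻¹' (rng '' (V ∩ {x | x⁻¹ ∈ W})) := by
    ext u
    exact e1 V W u
  have hW1 : ((↑) ⁻¹' {x : G | ∃ v ∈ W, ∃ w ∈ V, dom v = rng w ∧ x = v * w} :
      Set (units G)) = (↑) ⁻¹' (dom '' (V ∩ {x | x⁻¹ ∈ W})) := by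
    ext u
    refine (e1 W V u).trans ⟨?_, ?_⟩
    · rintro ⟨w, ⟨hw, hv⟩, e⟩
      exact ⟨w⁻¹, ⟨hv, by simpa [inv_inv'] using hw⟩, by rw [dom_inv, e]⟩
    · rintro ⟨v, ⟨hv, hw⟩, e⟩
      exact ⟨v⁻¹, ⟨hw, by rwa [inv_inv']⟩, by rw [rng_inv, e]⟩
  rw [hV1, hW1, hinv _ hB]

theorem integralDiagonal_mul_comm
    (hinv : ∀ V ∈ compactOpenBisections G, μ ((↑) ⁻¹' (rng '' V)) = μ ((↑) ⁻¹' (dom '' V)))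
    (a b : reducedCStarAlgebra G) : integralDiagonal μ (a * b) = integralDiagonal μ (b * a) := by
  have h := continuous_integralDiagonal (G := G) μ
  induction a using reducedCStarAlgebra_induction with
  | hchi V hV =>
    induction b using reducedCStarAlgebra_induction with
    | hchi W hW => exact integralDiagonal_chi_mul_comm μ hinv hV hW
    | hadd b b' hb hb' => exact map_mul_comm_add hb hb'
    | hsmul c b hb => exact map_mul_comm_smul c hb
    | hclosed => exact isClosed_map_mul_comm h _
  | hadd a a' ha ha' => exact (map_mul_comm_add ha.symm ha'.symm).symm
  | hsmul c a ha => exact (map_mul_comm_smul c ha.symm).symm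
  | hclosed =>
    simp only [eq_comm (a := integralDiagonal μ (_ * b))]
    exact isClosed_map_mul_comm h _

/-- The integral of the diagonal against an invariant measure of full support is a faithful
trace. -/
theorem isFaithfulTracialState_integralDiagonal (h1 : μ univ = 1)
    (hinv : ∀ V ∈ compactOpenBisections G,
      μ ((↑) ⁻¹' (rng '' V)) = μ ((↑) ⁻¹' (dom '' V)))
    [μ.IsOpenPosMeasure] : IsFaithfulTracialState (integralDiagonal (G := G) μ) := by
  -- Here `f u = ‖a δ_u‖²`.
  have hpos : ∀ a : reducedCStarAlgebra G, ∃ f : units G → ℝ, Continuous f ∧ 0 ≤ f ∧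
      integralDiagonal μ (star a * a) = (∫ u, f u ∂μ : ℝ) ∧
      (f = 0 → a = 0) := by
    intro a
    choose f hf using fun u : units G => coeff_star_mul_self (u : G) a
    refine ⟨f, ?_, fun u => (hf u).2.1, ?_, fun h0 => ?_⟩
    · have := Complex.continuous_re.comp (continuous_diagonal (star a * a))
      convert this using 1
      funext u
      simp [(hf u).1]
    · rw [integralDiagonal_apply, ← integral_complex_ofReal]
      exact congrArg _ (funext fun u => (hf u).1)
    · exact eq_zero_of_coeff fun x u hu => (hf ⟨u, hu⟩).2.2 (congrFun h0 _) x
  refine ⟨fun a => ?_, fun a => ?_, ?_, fun a b => ?_, fun a ha => ?_⟩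
  · obtain ⟨f, -, hf0, hf, -⟩ := hpos a
    rw [hf, Complex.ofReal_re]
    exact MeasureTheory.integral_nonneg hf0
  · obtain ⟨f, -, -, hf, -⟩ := hpos a
    rw [hf, Complex.ofReal_im]
  · rw [← chi_units, integralDiagonal_chi, Subtype.coe_preimage_self, MeasureTheory.measureReal_def,
      h1]
    simp
  · exact integralDiagonal_mul_comm μ hinv a b
  · obtain ⟨f, hfc, hf0, hf, h⟩ := hpos a
    rw [hf, Complex.ofReal_eq_zero, MeasureTheory.integral_eq_zero_iff_of_nonneg hf0
      (hfc.integrable_of_hasCompactSupport (HasCompactSupport.of_compactSpace _))] at ha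
    -- Full support upgrades vanishing almost everywhere to vanishing everywhere, by continuity of
    -- `f`.
    exact h (MeasureTheory.Measure.eq_of_ae_eq ha hfc continuous_zero)

end Trace

/-- A faithful normalised state on the type semigroup induces a faithful tracial state. -/
theorem exists_isFaithfulTracialState {φ : TypeSemigroup G → NNReal} (hφ : IsFaithfulState φ)
    (h1 : φ (typeClass (unitSpace G)) = 1) :
    ∃ τ : reducedCStarAlgebra G →ₗ[ℂ] ℂ, IsFaithfulTracialState τ := by
  let m : MeasurableSpace (units G) := borel _
  have : BorelSpace (units G) := ⟨rfl⟩
  let ι : TopologicalSpace.Clopens (units G) → CompactOpenUnits G := fun A =>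
    .of ((↑) '' (A : Set (units G)))
      (A.isClopen.isClosed.isCompact.image continuous_subtype_val)
      (isOpen_units.isOpenMap_subtype_val _ A.isClopen.isOpen) (by rintro _ ⟨u, -, rfl⟩; exact u.2)
  obtain ⟨μ, hμ⟩ := exists_measure_clopens (φ := fun A => φ (typeClass (ι A))) (by
    intro A B hd
    rw [← hφ.map_add, typeClass_union (A := ι A) (B := ι B)]
    · exact (disjoint_image_iff Subtype.val_injective).2 hd
    · change ((↑) '' ((A ⊔ B : TopologicalSpace.Clopens (units G)) : Set (units G)) : Set G) = _
      rw [TopologicalSpace.Clopens.coe_sup, image_union]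
      rfl)
  have hμ' : ∀ A : CompactOpenUnits G, μ ((↑) ⁻¹' A.1) = φ (typeClass A) := by
    intro A
    have h2 := hμ ⟨(↑) ⁻¹' A.1, IsClopen.preimage ⟨A.isClosed, A.isOpen⟩ continuous_subtype_val⟩
    refine h2.trans ?_
    congr 3
    refine Subtype.ext ?_
    change ((↑) '' ((↑) ⁻¹' A.1 : Set (units G)) : Set G) = A.1
    rw [Subtype.image_preimage_coe, inter_eq_right]
    exact A.2.2
  have huniv : μ univ = 1 := by
    have h2 := hμ' (unitSpace G)
    rw [h1] at h2
    rw [← ENNReal.coe_one, ← h2]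
    exact congrArg μ (Subtype.coe_preimage_self (units G)).symm
  have : MeasureTheory.IsFiniteMeasure μ := ⟨by rw [huniv]; exact ENNReal.one_lt_top⟩
  -- A non-empty open set contains a non-empty compact open `V`; if `μ(V) = 0`, faithfulness of the
  -- state gives `[V] = 0` and `V` is empty.
  have : μ.IsOpenPosMeasure := by
    refine ⟨fun U hU ⟨u, hu⟩ h0 => ?_⟩
    obtain ⟨U', hU', rfl⟩ := isOpen_induced_iff.1 hU
    obtain ⟨V, hV, huV, hVU⟩ := IsAmpleGroupoid.isTopologicalBasis.exists_subset_of_mem_open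
      (show (u : G) ∈ U' ∩ units G from ⟨hu, u.2⟩) (hU'.inter isOpen_units)
    have h2 : μ ((↑) ⁻¹' V) = 0 :=
      MeasureTheory.measure_mono_null (preimage_mono (hVU.trans inter_subset_left)) h0
    rw [hμ' ⟨V, hV, hVU.trans inter_subset_right⟩, ENNReal.coe_eq_zero] at h2
    have := eq_empty_of_typeClass_eq_zero (hφ.faithful _ h2)
    rw [show V = ∅ from this] at huV
    exact huV
  exact ⟨_, isFaithfulTracialState_integralDiagonal μ huniv fun V hV => by
    exact (hμ' (.rngOf V hV)).trans (by rw [typeClass_rngOf]; exact (hμ' (.domOf V hV)).symm)⟩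

end AlgGroupoid

/-! ### Traces and stable finiteness -/

/-- `τ ∘ Tr` vanishes on `1 - q = v* v - v v*`. As `p = 1 - q` is a projection, this value is a sum
of the non-negative numbers `τ(p_{ji}* p_{ji})`, so every entry of `p` is zero. -/
theorem IsFaithfulTracialState.isStablyFinite {A : Type*} [Ring A] [StarRing A] [Algebra ℂ A]
    {τ : A →ₗ[ℂ] ℂ} (hτ : IsFaithfulTracialState τ) : IsStablyFinite A := by
  intro n
  refine ⟨.one _, fun q v hq _ h1 h2 => ?_⟩
  have htr : ∀ x y : Matrix (Fin n) (Fin n) A, τ (x * y).trace = τ (y * x).trace := by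
    intro x y
    simp only [Matrix.trace, Matrix.diag, Matrix.mul_apply, map_sum]
    rw [Finset.sum_comm]
    exact Finset.sum_congr rfl fun i _ => Finset.sum_congr rfl fun j _ => hτ.trace _ _
  obtain ⟨p, hp⟩ : ∃ p, p = 1 - q := ⟨_, rfl⟩
  have hpp : star p * p = p := by
    have := hq.one_sub
    rw [hp, this.2.star_eq, this.1.eq]
  have h0 : τ (star p * p).trace = 0 := by
    rw [hpp, hp, Matrix.trace_sub, map_sub, ← h1, ← h2, htr, sub_self]
  have hsum : ∑ i, ∑ j, (τ (star (p j i) * p j i)).re = 0 := by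
    have := congrArg Complex.re h0
    simpa [Matrix.trace, Matrix.mul_apply, Matrix.star_apply] using this
  have hnn : ∀ i j, 0 ≤ (τ (star (p j i) * p j i)).re := fun i j => hτ.nonneg_re _
  have hp0 : p = 0 := by
    ext1 j i
    rw [Finset.sum_eq_zero_iff_of_nonneg fun i _ => Finset.sum_nonneg fun j _ => hnn i j] at hsum
    have h3 := hsum i (Finset.mem_univ i)
    rw [Finset.sum_eq_zero_iff_of_nonneg fun j _ => hnn i j] at h3
    exact hτ.faithful _ (Complex.ext (h3 j (Finset.mem_univ j)) (hτ.im_eq_zero _))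
  rw [hp0] at hp
  exact (sub_eq_zero.1 hp.symm).symm

theorem mainTheorem5 {G : Type*} [AlgGroupoid G] [TopologicalSpace G] [LocallyCompactSpace G]
    [T2Space G] [IsAmpleGroupoid G] [Nonempty G] [CompactSpace (AlgGroupoid.units G)]
    (hmin : IsMinimalGroupoid G) :
    List.TFAE [
      ∃ τ : AlgGroupoid.reducedCStarAlgebra G →ₗ[ℂ] ℂ, IsFaithfulTracialState τ,
      IsStablyFinite (AlgGroupoid.reducedCStarAlgebra G),
      ∀ A : Set G, A ⊆ AlgGroupoid.units G → IsClopen ((↑) ⁻¹' A : Set (AlgGroupoid.units G)) →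
        AlgGroupoid.IsCompletelyNonParadoxical (AlgGroupoid.compactOpenBisections G) A,
      ∃ φ : AlgGroupoid.TypeSemigroup G → NNReal, IsFaithfulState φ ∧
        φ (AlgGroupoid.typeClass (AlgGroupoid.unitSpace G)) = 1] := by
  tfae_have 1 → 2 := fun ⟨_, hτ⟩ => hτ.isStablyFinite
  tfae_have 2 → 3 := fun h _ _ _ _ _ _ _ => not_isParadoxical_of_isStablyFinite h
  -- Only the whole unit space is needed from the third condition.
  tfae_have 3 → 4 := fun h =>
    exists_isFaithfulState hmin (h _ subset_rfl (by rw [Subtype.coe_preimage_self]; exact isClopen_univ))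
  tfae_have 4 → 1 := fun ⟨_, hφ, h1⟩ => exists_isFaithfulTracialState hφ h1
  tfae_finish
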